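/- Theorem 1.1. Let $p\ge 1$, let $V:\mathbb Z\to\mathbb R$ be $p$-periodic, and let $H$ be the Jacobi (discrete Schrödinger) operator on $\ell^2(\mathbb Z)$, $(Hu)(n)=u(n+1)+u(n-1)+V(n)u(n)$. For $E\in\mathbb R$ let $$M_E(p)=\begin{pmatrix}E-V(p)&-1\\1&0\end{pmatrix}\cdots\begin{pmatrix}E-V(1)&-1\\1&0\end{pmatrix}$$ be the $p$-step transfer matrix and $D(E)=\operatorname{Tr}M_E(p)$ the discriminant. For $\theta\in\mathbb R$ and $L\ge 2$ let $H_L$ be the restriction of $H$ to $\{1,\dots,L-1\}$ with boundary conditions $\sin\theta\,u(0)=\cos\theta\,u(1)$ and $u(L)=0$, and let $k_L(E)=\frac1{L-1}\#\{\lambda\in\sigma(H_L):\lambda\le E\}$. Then for all $E\in\mathbb R$ the limit $k^H(E)=\lim_{L\to\infty}k_L(E)$ (the integrated density of states) exists and does not depend on $\theta$. The spectrum of $H$ is the union of $p$ bands $B_j=[a_j,b_j]$, $j=1,\dots,p$, with $$a_1<b_1\le a_2<b_2\le\dots\le a_p<b_p,$$ where the band edges $a_j,b_j$ are exactly the points of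 $\sigma(H)$ at which $D=\pm2$. Let $G_0=(-\infty,a_1)$, $G_p=(b_p,\infty)$, and for $1\le j\le p-1$ let $G_j=(b_j,a_{j+1})$ if $b_j<a_{j+1}$ and $G_j=\{b_j\}=\{a_{j+1}\}$ if $b_j=a_{j+1}$ be the gaps. For each $E\in\sigma(H)$ there is exactly one $\vartheta\in[0,\pi/p]$ with $D(E)=2\cos(p\vartheta)$, and, with this $\vartheta$, $$k^H(E)=\begin{cases}\dfrac jp, & E\in G_j,\ 0\le j\le p,\\[1ex] \dfrac jp-\dfrac\vartheta\pi, & E\in B_j,\ 1\le j\le p,\ p-j\text{ even},\\[1ex] \dfrac{j-1}p+\dfrac\vartheta\pi, & E\in B_j,\ 1\le j\le p,\ p-j\text{ odd}.\end{cases}$$ -/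

import Mathlib

open Set Filter Topology

noncomputable section

namespace PeriodicJacobi

/-- The Hilbert space `ℓ²(ℤ)` of complex square-summable two-sided sequences. -/
abbrev L2Z : Type := lp (fun _ : ℤ => ℂ) 2

/-- Translation `(S_k u)(n) = u (n + k)` on `ℓ²(ℤ)`. -/
def shift (k : ℤ) : L2Z →L[ℂ] L2Z :=
  have hmem : ∀ u : L2Z, Memℓp (fun n : ℤ => u (n + k)) 2 := fun u => by
    refine memℓp_gen ?_
    have h := (lp.memℓp u).summable (by norm_num : 0 < (2 : ENNReal).toReal)
    exact (Equiv.addRight k).summable_iff.mpr h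
  LinearMap.mkContinuous
    { toFun := fun u => ⟨fun n => u (n + k), hmem u⟩
      map_add' := fun _ _ => rfl
      map_smul' := fun _ _ => rfl } 1 (fun u => by
      have h2 : 0 < (2 : ENNReal).toReal := by norm_num
      rw [one_mul, lp.norm_eq_tsum_rpow h2, lp.norm_eq_tsum_rpow h2]
      refine le_of_eq ?_
      congr 1
      exact (Equiv.addRight k).tsum_eq (fun n : ℤ => ‖u n‖ ^ (2 : ENNReal).toReal))

@[simp] theorem shift_apply (k : ℤ) (u : L2Z) (n : ℤ) : shift k u n = u (n + k) := rfl

theorem norm_smul_id_le {V : ℤ → ℝ} {C : ℝ} (hC : ∀ n, |V n| ≤ C) (n : ℤ) :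
    ‖(V n : ℂ) • ContinuousLinearMap.id ℂ ℂ‖ ≤ C := by
  rw [norm_smul, ContinuousLinearMap.norm_id, mul_one, Complex.norm_real]
  exact hC n

/-- Multiplication by a bounded real potential on `ℓ²(ℤ)`. -/
def potential (V : ℤ → ℝ) (hV : ∃ C, ∀ n, |V n| ≤ C) : L2Z →L[ℂ] L2Z :=
  lp.mapCLM 2 (fun n : ℤ => (V n : ℂ) • ContinuousLinearMap.id ℂ ℂ)
    ((abs_nonneg (V 0)).trans (hV.choose_spec 0)) (norm_smul_id_le hV.choose_spec)

@[simp] theorem potential_apply (V : ℤ → ℝ) (hV : ∃ C, ∀ n, |V n| ≤ C) (u : L2Z) (n : ℤ) :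
    potential V hV u n = (V n : ℂ) * u n := rfl

/-- The discrete Schrödinger (Jacobi) operator `H` on `ℓ²(ℤ)` with bounded real potential `V`. -/
def jacobi (V : ℤ → ℝ) (hV : ∃ C, ∀ n, |V n| ≤ C) : L2Z →L[ℂ] L2Z :=
  shift 1 + shift (-1) + potential V hV

theorem jacobi_apply (V : ℤ → ℝ) (hV : ∃ C, ∀ n, |V n| ≤ C) (u : L2Z) (n : ℤ) :
    jacobi V hV u n = u (n + 1) + u (n - 1) + (V n : ℂ) * u n := rfl

/-- A periodic potential is bounded. -/
theorem bounded_of_periodic {p : ℕ} (hp : 0 < p) {V : ℤ → ℝ}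
    (hV : Function.Periodic V (p : ℤ)) : ∃ C, ∀ n, |V n| ≤ C := by
  refine ⟨∑ i ∈ Finset.range p, |V i|, fun n => ?_⟩
  have hp' : (0 : ℤ) < p := by exact_mod_cast hp
  have h1 : V n = V (n % p) := by
    have h := hV.int_mul (n / p) (n % p)
    rw [← h]
    congr 1
    have := Int.emod_add_mul_ediv n p
    simp only [Int.cast_id]
    linarith [mul_comm (n / (p : ℤ)) (p : ℤ)]
  have h0 := Int.emod_nonneg n hp'.ne'
  have h2 := Int.emod_lt_of_pos n hp'
  obtain ⟨m, hm⟩ := Int.eq_ofNat_of_zero_le h0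
  rw [h1, hm]
  exact Finset.single_le_sum (f := fun i : ℕ => |V i|) (fun i _ => abs_nonneg _)
    (Finset.mem_range.mpr (by omega))

/-- The transfer matrix `M_E(n)`: every solution of `u (k+1) + u (k-1) + V k * u k = E * u k`
satisfies `(u (n+1), u n)ᵀ = M_E(n) (u 1, u 0)ᵀ`. -/
def transfer (V : ℤ → ℝ) (E : ℝ) : ℕ → Matrix (Fin 2) (Fin 2) ℝ
  | 0 => 1
  | n + 1 => !![E - V (n + 1), -1; 1, 0] * transfer V E n

/-- The discriminant `D(E) = Tr M_E(p)`. -/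
def discriminant (p : ℕ) (V : ℤ → ℝ) (E : ℝ) : ℝ := (transfer V E p).trace

/-- The spectrum of the restriction `H_L` of `H` to the sites `1, …, L - 1` with boundary
conditions `u 0 / u 1 = cot θ` (i.e. `sin θ * u 0 = cos θ * u 1`) and `u L = 0`: the set of
its eigenvalues. -/
def finiteSpectrum (V : ℤ → ℝ) (θ : ℝ) (L : ℕ) : Set ℝ :=
  {lam | ∃ u : ℤ → ℝ,
    (∃ n : ℤ, 1 ≤ n ∧ n < L ∧ u n ≠ 0) ∧
    Real.sin θ * u 0 = Real.cos θ * u 1 ∧ u L = 0 ∧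
    ∀ n : ℤ, 1 ≤ n → n < L → u (n + 1) + u (n - 1) + V n * u n = lam * u n}

/-- The finite-volume integrated density of states `k_L(E)`. -/
def finiteIDS (V : ℤ → ℝ) (θ : ℝ) (L : ℕ) (E : ℝ) : ℝ :=
  ({lam ∈ finiteSpectrum V θ L | lam ≤ E}.ncard : ℝ) / ((L : ℝ) - 1)

/-- `k` is the integrated density of states of `H`: for every energy, `k E` is the limit of the
finite-volume ones, whatever the boundary condition `θ` is. -/
def IsIDS (V : ℤ → ℝ) (k : ℝ → ℝ) : Prop :=
  ∀ E θ : ℝ, Tendsto (fun L : ℕ => finiteIDS V θ L E) atTop (𝓝 (k E))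

/-- `[a j, b j]`, `j = 1, …, p`, are the `p` bands of `σ(H)`: nondegenerate compact intervals,
ordered and with disjoint interiors, whose union is `σ(H)`. Two consecutive bands may touch, at
a collapsed gap; the edges of the bands (collapsed gaps included) are the points of the bands
where the discriminant is `2` or `-2`. -/
structure IsBands (p : ℕ) (V : ℤ → ℝ) (hV : ∃ C, ∀ n, |V n| ≤ C) (a b : ℕ → ℝ) : Prop where
  lt : ∀ j, 1 ≤ j → j ≤ p → a j < b j
  le : ∀ j, 1 ≤ j → j < p → b j ≤ a (j + 1)
  spectrum_eq : spectrum ℂ (jacobi V hV) =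
    Complex.ofReal '' {E : ℝ | ∃ j, 1 ≤ j ∧ j ≤ p ∧ E ∈ Icc (a j) (b j)}
  edge : ∀ j, 1 ≤ j → j ≤ p → ∀ E ∈ Icc (a j) (b j),
    |discriminant p V E| = 2 ↔ E = a j ∨ E = b j

/-- The `j`-th gap, `0 ≤ j ≤ p`: unbounded for `j = 0` and `j = p`; otherwise open, or
collapsed to the common edge of two touching bands. -/
def gap (p : ℕ) (a b : ℕ → ℝ) (j : ℕ) : Set ℝ :=
  if j = 0 then Iio (a 1)
  else if j = p then Ioi (b p)
  else if b j < a (j + 1) then Ioo (b j) (a (j + 1))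
  else {b j}

end PeriodicJacobi

end

/-
The discriminant `D` is a monic polynomial of degree `p`. If `D z = t` with `|t| ≤ 2`, the periodic
recurrence at the energy `z` has a bounded solution, whose truncations are approximate eigenvectors
of the self-adjoint operator `H`; hence `z` is real and lies in `σ(H)`. Conversely, let `S` be the
translation by `p`. By Floquet's relation `S + S⁻¹ - D(E)` lies in the left ideal generated by
`H - E`, and it is invertible if `|D E| > 2`, since `S` is an isometry; then the self-adjoint
operator `H - E` is left invertible, so invertible. Thus `σ(H) = {|D| ≤ 2}`, and for `|t| < 2` all
zeros of `D - t` are real. Laguerre's inequality for `D - t` then makes `D` strictly monotone where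
`|D| < 2`, which gives exactly `p` bands.

The eigenvalues of `H_L` are zeros of a polynomial solution of the recurrence, and interlacing moves
their number below `E` by at most one when the boundary condition or `L` changes by one step. For
`L = p (N + 1)` and Dirichlet conditions that polynomial is `s_p * S_N(D)`, where `s_p` does not
depend on `N` and `S_N` is the Chebyshev polynomial with zeros `2 cos (π k / (N + 1))`. Each band
contains one preimage of each of these zeros, and counting the preimages below `E` in the coordinate
`D = 2 cos (p ϑ)` gives `k^H`.
-/

noncomputable section

namespace PeriodicJacobi

section Recurrence

variable {R : Type*} [CommRing R]

/-- The solution of the eigenvalue recurrence `u (n + 2) + u n = w (n + 1) * u (n + 1)` with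
`u 0 = x` and `u 1 = y`; at energy `E` one takes `w k = E - V k`. The pair `sol w 1 0`,
`sol w 0 1` is the fundamental system. -/
def sol (w : ℕ → R) (x y : R) : ℕ → R
  | 0 => x
  | 1 => y
  | n + 2 => w (n + 1) * sol w x y (n + 1) - sol w x y n

@[simp] theorem sol_zero (w : ℕ → R) (x y : R) : sol w x y 0 = x := rfl

@[simp] theorem sol_one (w : ℕ → R) (x y : R) : sol w x y 1 = y := rfl

theorem sol_add_two (w : ℕ → R) (x y : R) (n : ℕ) :
    sol w x y (n + 2) = w (n + 1) * sol w x y (n + 1) - sol w x y n := rfl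

theorem eq_sol_of_recurrence {w u : ℕ → R} {N : ℕ}
    (hu : ∀ n, n + 2 ≤ N → u (n + 2) = w (n + 1) * u (n + 1) - u n) {n : ℕ} (hn : n ≤ N) :
    u n = sol w (u 0) (u 1) n := by
  induction n using Nat.twoStepInduction with
  | zero => rfl
  | one => rfl
  | more n ih₀ ih₁ => rw [hu n hn, ih₀ (by omega), ih₁ (by omega), sol_add_two]

theorem sol_eq_linear (w : ℕ → R) (x y : R) (n : ℕ) :
    sol w x y n = x * sol w 1 0 n + y * sol w 0 1 n := by
  induction n using Nat.twoStepInduction with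
  | zero => simp
  | one => simp
  | more n ih₀ ih₁ => simp only [sol_add_two, ih₀, ih₁]; ring

theorem map_sol {S : Type*} [CommRing S] (f : R →+* S) (w : ℕ → R) (x y : R) (n : ℕ) :
    f (sol w x y n) = sol (fun k => f (w k)) (f x) (f y) n := by
  induction n using Nat.twoStepInduction with
  | zero => rfl
  | one => rfl
  | more n ih₀ ih₁ => simp only [sol_add_two, map_sub, map_mul, ih₀, ih₁]

theorem sol_add (w : ℕ → R) (x y : R) (n m : ℕ) :
    sol w x y (n + m) =
      sol (fun k => w (k + m)) (sol w x y m) (sol w x y (m + 1)) n := by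
  induction n using Nat.twoStepInduction with
  | zero => simp
  | one => simp [add_comm]
  | more n ih₀ ih₁ =>
    rw [sol_add_two, ← ih₀, ← ih₁, show n + 2 + m = (n + m) + 2 by ring, sol_add_two,
      show n + m + 1 = n + 1 + m by ring]

theorem sol_casoratian (w : ℕ → R) (n : ℕ) :
    sol w 0 1 (n + 1) * sol w 1 0 n - sol w 0 1 n * sol w 1 0 (n + 1) = 1 := by
  induction n with
  | zero => simp
  | succ n ih => rw [sol_add_two, sol_add_two]; linear_combination ih

theorem sol_one_zero_succ (w : ℕ → R) (n : ℕ) :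
    sol w 1 0 (n + 1) = -sol (fun k => w (k + 1)) 0 1 n := by
  rw [sol_add, sol_eq_linear]
  simp [sol_add_two]

theorem sol_zero_one_add_two (w : ℕ → R) (n : ℕ) :
    sol w 0 1 (n + 2) =
      w 1 * sol (fun k => w (k + 1)) 0 1 (n + 1) - sol (fun k => w (k + 2)) 0 1 n := by
  rw [show n + 2 = n + 1 + 1 from rfl, sol_add w 0 1 (n + 1) 1, sol_eq_linear,
    sol_one_zero_succ]
  simp only [sol_one, sol_add_two, sol_zero, zero_add, add_assoc, Nat.reduceAdd]
  ring

/-- The trace of the transfer matrix over the sites `1, …, p` of the recurrence `sol w`. -/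
def trace (w : ℕ → R) (p : ℕ) : R := sol w 0 1 (p + 1) + sol w 1 0 p

theorem map_trace {S : Type*} [CommRing S] (f : R →+* S) (w : ℕ → R) (p : ℕ) :
    f (trace w p) = trace (fun k => f (w k)) p := by
  simp only [trace, map_add, map_sol, map_zero, map_one]

theorem trace_shift {w : ℕ → R} {p : ℕ} (hp : 0 < p) (hw : w (p + 1) = w 1) :
    trace (fun k => w (k + 1)) p = trace w p := by
  obtain ⟨q, rfl⟩ : ∃ q, p = q + 1 := ⟨p - 1, by omega⟩
  have hleft := sol_zero_one_add_two w q
  rw [trace, trace, hleft, sol_one_zero_succ w q, sol_one_zero_succ _ q, sol_add_two, hw]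
  ring

theorem sol_add_period {w : ℕ → R} {p : ℕ} (hw : Function.Periodic w p) (x y : R) (n : ℕ) :
    sol w x y (n + p) = sol w x y p * sol w 1 0 n + sol w x y (p + 1) * sol w 0 1 n := by
  rw [sol_add, funext hw, sol_eq_linear]

-- Cayley–Hamilton for the period map, whose determinant is the Casoratian.
theorem sol_add_two_mul_period {w : ℕ → R} {p : ℕ} (hw : Function.Periodic w p) (x y : R)
    (n : ℕ) :
    sol w x y (n + 2 * p) + sol w x y n = trace w p * sol w x y (n + p) := by
  rw [show n + 2 * p = n + p + p by ring, sol_add_period hw x y (n + p), sol_add_period hw x y n,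
    sol_add_period hw 1 0 n, sol_add_period hw 0 1 n, sol_eq_linear w x y n,
    sol_eq_linear w x y p, sol_eq_linear w x y (p + 1), trace]
  linear_combination (-(x * sol w 1 0 n + y * sol w 0 1 n)) * sol_casoratian w p

end Recurrence

section PolynomialRecurrence

open Polynomial

variable {R : Type*} [CommRing R]

theorem eval_sol (v : ℕ → R) (x y E : R) (n : ℕ) :
    (sol (fun k => X - C (v k)) (C x) (C y) n).eval E = sol (fun k => E - v k) x y n := by
  rw [← coe_evalRingHom, map_sol]
  simp

theorem eval_trace (v : ℕ → R) (p : ℕ) (E : R) :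
    (trace (fun k => X - C (v k)) p).eval E = trace (fun k => E - v k) p := by
  rw [← coe_evalRingHom, map_trace]
  simp

theorem isMonicOfDegree_sol [Nontrivial R] (v : ℕ → R) (n : ℕ) :
    IsMonicOfDegree (sol (fun k => X - C (v k)) 0 1 (n + 1)) n := by
  induction n using Nat.twoStepInduction with
  | zero => simp
  | one => simpa [sol_add_two] using isMonicOfDegree_X_sub_one (v 1)
  | more n ih₀ ih₁ =>
    have hmul := (isMonicOfDegree_X_sub_one (v (n + 2))).mul ih₁
    rw [add_comm 1] at hmul
    exact hmul.sub (by rw [ih₀.natDegree_eq]; omega)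

theorem natDegree_sol_lt [Nontrivial R] (v : ℕ → R) {n : ℕ} (hn : 0 < n) :
    (sol (fun k => X - C (v k)) 0 1 n).natDegree < n := by
  obtain ⟨m, rfl⟩ : ∃ m, n = m + 1 := ⟨n - 1, by omega⟩
  rw [(isMonicOfDegree_sol v m).natDegree_eq]
  exact m.lt_succ_self

theorem isMonicOfDegree_trace [Nontrivial R] (v : ℕ → R) {p : ℕ} (hp : 0 < p) :
    IsMonicOfDegree (trace (fun k => X - C (v k)) p) p := by
  obtain ⟨q, rfl⟩ : ∃ q, p = q + 1 := ⟨p - 1, by omega⟩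
  refine (isMonicOfDegree_sol v (q + 1)).add_right ?_
  rw [sol_one_zero_succ, natDegree_neg]
  rcases q.eq_zero_or_pos with rfl | hq
  · simp
  · exact (natDegree_sol_lt (fun k => v (k + 1)) hq).trans q.lt_succ_self

theorem wronskian_C_mul_left (c : R) (a b : R[X]) :
    wronskian (C c * a) b = C c * wronskian a b := by
  simp only [wronskian, derivative_C_mul]
  ring

theorem wronskian_X_sub_C_mul_sub (a b : R[X]) (c : R) :
    wronskian a ((X - C c) * a - b) = a ^ 2 + wronskian b a := by
  simp only [wronskian, derivative_sub, derivative_mul, derivative_X, derivative_C]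
  ring

variable [LinearOrder R] [IsStrictOrderedRing R]

theorem eval_wronskian_sol_succ_pos (v : ℕ → R) (n : ℕ) (E : R) :
    0 < (wronskian (sol (fun k => X - C (v k)) 0 1 (n + 1))
      (sol (fun k => X - C (v k)) 0 1 (n + 2))).eval E := by
  induction n with
  | zero => simp [sol_add_two, wronskian]
  | succ n ih =>
    rw [sol_add_two _ _ _ (n + 1), wronskian_X_sub_C_mul_sub, eval_add, eval_pow]
    positivity

theorem eval_wronskian_sol_shift_pos (v : ℕ → R) (n : ℕ) (E : R) :
    0 < (wronskian (sol (fun k => X - C (v (k + 1))) 0 1 (n + 1))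
      (sol (fun k => X - C (v k)) 0 1 (n + 2))).eval E := by
  induction n generalizing v with
  | zero => simp [sol_add_two, wronskian]
  | succ n ih =>
    have hpos := ih fun k => v (k + 1)
    rw [sol_zero_one_add_two (fun k => X - C (v k)), wronskian_X_sub_C_mul_sub, eval_add, eval_pow]
    exact add_pos_of_nonneg_of_pos (sq_nonneg _) hpos

end PolynomialRecurrence

section RealLevels

open Polynomial

theorem wronskian_derivative_mul {R : Type*} [CommRing R] (q r : R[X]) :
    wronskian (derivative (q * r)) (q * r) =
      r ^ 2 * wronskian (derivative q) q + q ^ 2 * wronskian (derivative r) r := by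
  simp only [wronskian, derivative_mul, derivative_add]
  ring

/-- Laguerre's inequality `q * q'' ≤ q' ^ 2`, written with the Wronskian of `q'` and `q`. -/
theorem laguerre_nonneg {q : ℝ[X]} (hq : q.Splits) (x : ℝ) :
    0 ≤ (wronskian (derivative q) q).eval x := by
  induction hq using Submonoid.closure_induction with
  | mem r hr => rcases hr with ⟨c, rfl⟩ | ⟨c, rfl⟩ <;> simp [wronskian]
  | one => simp [wronskian]
  | mul r s _ _ hr hs =>
    rw [wronskian_derivative_mul, eval_add, eval_mul, eval_mul, eval_pow, eval_pow]
    positivity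

theorem laguerre_pos {q : ℝ[X]} (hq : q.Splits) (hdeg : q.degree ≠ 0) {x : ℝ}
    (hx : q.eval x ≠ 0) : 0 < (wronskian (derivative q) q).eval x := by
  have hq₀ : q ≠ 0 := fun h => hx (by rw [h, eval_zero])
  obtain ⟨r, hr⟩ := hq.exists_eval_eq_zero hdeg
  obtain ⟨s, rfl⟩ := dvd_iff_isRoot.mpr hr
  have hs := laguerre_nonneg (hq.of_dvd hq₀ (dvd_mul_left s _)) x
  have hsx : s.eval x ≠ 0 := fun h => hx (by rw [eval_mul, h, mul_zero])
  have hlin : wronskian (derivative (X - C r)) (X - C r) = 1 := by simp [wronskian]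
  rw [wronskian_derivative_mul, hlin]
  simp only [eval_add, eval_mul, eval_pow, mul_one]
  positivity

/-- A real polynomial has real levels if, for `|t| < 2`, it takes the value `t` at real points
only. This is the property of the discriminant on which the band structure rests. -/
def RealLevels (f : ℝ[X]) : Prop := ∀ t : ℝ, |t| < 2 → (f - C t).Splits

namespace RealLevels

variable {f : ℝ[X]}

theorem mul_eval_second_derivative_neg (hf : RealLevels f) (hdeg : 0 < f.degree) {x t : ℝ}
    (hx : (derivative f).eval x = 0) (ht : |t| < 2) (hne : f.eval x ≠ t) :
    (f.eval x - t) * (derivative (derivative f)).eval x < 0 := by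
  have hpos := laguerre_pos (hf t ht) (by rw [degree_sub_C hdeg]; exact hdeg.ne') (x := x)
    (by rwa [eval_sub, eval_C, sub_ne_zero])
  simp only [wronskian, derivative_sub, derivative_C, sub_zero, eval_sub, eval_mul, eval_C, hx]
    at hpos
  linarith

theorem two_le_abs_of_derivative_eq_zero (hf : RealLevels f) (hdeg : 0 < f.degree) {x : ℝ}
    (hx : (derivative f).eval x = 0) : 2 ≤ |f.eval x| := by
  by_contra! hlt
  obtain ⟨hlo, hhi⟩ := abs_lt.mp hlt
  obtain ⟨t, ht, ht'⟩ := exists_between hlo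
  obtain ⟨s, hs, hs'⟩ := exists_between hhi
  have habove := hf.mul_eval_second_derivative_neg hdeg hx
    (abs_lt.mpr ⟨ht, ht'.trans hhi⟩) ht'.ne'
  have hbelow := hf.mul_eval_second_derivative_neg hdeg hx
    (abs_lt.mpr ⟨hlo.trans hs, hs'⟩) hs.ne
  nlinarith

theorem mem_closure_abs_lt (hf : RealLevels f) (hdeg : 0 < f.degree) {y : ℝ}
    (hy : |f.eval y| ≤ 2) : y ∈ closure {x | |f.eval x| < 2} := by
  -- Otherwise `y` is both a local minimum and a local maximum of `f ^ 2`.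
  by_contra hcl
  have hge : ∀ᶠ x in 𝓝 y, (2 : ℝ) ≤ |f.eval x| := by
    filter_upwards [isClosed_closure.isOpen_compl.mem_nhds hcl] with x hx
    exact not_lt.mp fun h => hx (subset_closure h)
  have hy₂ : |f.eval y| = 2 := hy.antisymm hge.self_of_nhds
  set g : ℝ → ℝ := fun x => (f ^ 2).eval x
  have hg' : deriv g = fun x => (derivative (f ^ 2)).eval x := funext fun x => (f ^ 2).deriv
  have hg'' : deriv (deriv g) y = (derivative (derivative (f ^ 2))).eval y := by
    rw [hg', Polynomial.deriv]
  have hmin : IsLocalMin g y := by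
    filter_upwards [hge] with x hx
    simpa only [g, eval_pow, sq_le_sq, hy₂] using hx
  have hcrit : deriv g y = 0 := hmin.deriv_eq_zero
  have hy₀ : f.eval y ≠ 0 := fun h => by simp [h] at hy₂
  have hf' : (derivative f).eval y = 0 := by
    simpa [hg', sq, derivative_mul, hy₀, mul_comm, ← two_mul] using hcrit
  have hneg : deriv (deriv g) y < 0 := by
    have := hf.mul_eval_second_derivative_neg hdeg hf' (t := 0) (by norm_num) hy₀
    rw [hg'']
    simp only [sq, derivative_mul, derivative_add, eval_add, eval_mul, hf']
    linarith
  have hmax : IsLocalMax g y :=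
    isLocalMax_of_deriv_deriv_neg hneg hcrit (f ^ 2).continuous.continuousAt
  have hconst : g =ᶠ[𝓝 y] fun _ => g y := by
    filter_upwards [hmin, hmax] with x h₁ h₂ using le_antisymm h₂ h₁
  rw [hconst.deriv.deriv_eq] at hneg
  simp at hneg

theorem card_roots_toFinset (hf : RealLevels f) (hdeg : 0 < f.degree) :
    f.roots.toFinset.card = f.natDegree := by
  have hsplits : f.Splits := by simpa using hf 0 (by norm_num)
  have hnodup : f.roots.Nodup := by
    rw [Multiset.nodup_iff_count_le_one]
    intro x
    rw [count_roots]
    by_contra! hlt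
    obtain ⟨hx, hx'⟩ := (one_lt_rootMultiplicity_iff_isRoot (ne_zero_of_degree_gt hdeg)).mp hlt
    have := hf.two_le_abs_of_derivative_eq_zero hdeg hx'
    rw [hx.eq_zero, abs_zero] at this
    norm_num at this
  rw [Multiset.toFinset_card_of_nodup hnodup, hsplits.natDegree_eq_card_roots]

end RealLevels

theorem exists_first_hit {f : ℝ → ℝ} (hf : Continuous f) {c y z : ℝ} (hy : f y < c) (hyz : y ≤ z)
    (hz : c ≤ f z) : ∃ b, y < b ∧ f b = c ∧ ∀ x ∈ Ico y b, f x < c := by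
  have hhit : ∀ x, y ≤ x → c ≤ f x → ∃ w ∈ Icc y x, f w = c := fun x hx hcx =>
    intermediate_value_Icc hx hf.continuousOn ⟨hy.le, hcx⟩
  have hcompact : IsCompact (Icc y z ∩ f ⁻¹' {c}) :=
    isCompact_Icc.inter_right (isClosed_singleton.preimage hf)
  obtain ⟨b, ⟨hb, hfb⟩, hleast⟩ := hcompact.exists_isLeast (hhit z hyz hz)
  refine ⟨b, hb.1.lt_of_ne ?_, hfb, fun x hx => not_le.mp fun hcx => ?_⟩
  · rintro rfl
    exact hy.ne hfb
  · obtain ⟨w, hw, hfw⟩ := hhit x hx.1 hcx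
    exact (hw.2.trans_lt hx.2).not_ge (hleast ⟨⟨hw.1, (hw.2.trans_lt hx.2).le.trans hb.2⟩, hfw⟩)

/-- `[a, b]` is a band of `f`: the closure of a component of `{|f| < 2}`. -/
structure IsBand (f : ℝ[X]) (a b : ℝ) : Prop where
  lt : a < b
  abs_left : |f.eval a| = 2
  abs_right : |f.eval b| = 2
  abs_lt : ∀ x ∈ Ioo a b, |f.eval x| < 2

theorem exists_isBand {f : ℝ[X]} (hdeg : 0 < f.degree) {y : ℝ} (hy : |f.eval y| < 2) :
    ∃ a b, IsBand f a b ∧ y ∈ Ioo a b := by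
  have hright : ∀ g : ℝ[X], 0 < g.degree → ∀ x : ℝ, |g.eval x| < 2 →
      ∃ b, x < b ∧ |g.eval b| = 2 ∧ ∀ z ∈ Ico x b, |g.eval z| < 2 := fun g hg x hx => by
    have hT := g.tendsto_norm_atTop hg (z := fun x : ℝ => x) tendsto_norm_atTop_atTop
    obtain ⟨z, hz, hxz⟩ := ((hT.eventually_ge_atTop 2).and (eventually_ge_atTop x)).exists
    exact exists_first_hit g.continuous.abs hx hxz hz
  obtain ⟨b, hyb, hb, hlt⟩ := hright f hdeg y hy
  obtain ⟨a, hya, ha, hlt'⟩ := hright (f.comp (-X))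
    (by rwa [← natDegree_pos_iff_degree_pos, natDegree_comp, natDegree_neg, natDegree_X, mul_one,
      natDegree_pos_iff_degree_pos]) (-y) (by simpa using hy)
  refine ⟨-a, b, ⟨by linarith, by simpa using ha, hb, fun x hx => ?_⟩, by linarith, hyb⟩
  rcases le_total y x with hyx | hxy
  · exact hlt x ⟨hyx, hx.2⟩
  · simpa using hlt' (-x) ⟨by linarith, by linarith [hx.1]⟩

namespace IsBand

variable {f : ℝ[X]} {a b a' b' x : ℝ}

theorem abs_le (h : IsBand f a b) (hx : x ∈ Icc a b) : |f.eval x| ≤ 2 := by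
  rcases hx.1.eq_or_lt with rfl | hax
  · exact h.abs_left.le
  rcases hx.2.eq_or_lt with rfl | hxb
  · exact h.abs_right.le
  exact (h.abs_lt x ⟨hax, hxb⟩).le

theorem abs_eq_two_iff (h : IsBand f a b) (hx : x ∈ Icc a b) :
    |f.eval x| = 2 ↔ x = a ∨ x = b := by
  refine ⟨fun hx₂ => ?_, ?_⟩
  · by_contra! hne
    exact (h.abs_lt x ⟨hx.1.lt_of_ne hne.1.symm, hx.2.lt_of_ne hne.2⟩).ne hx₂
  · rintro (rfl | rfl)
    exacts [h.abs_left, h.abs_right]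

theorem mem_Ioo (h : IsBand f a b) (hx : x ∈ Icc a b) (hx₂ : |f.eval x| < 2) : x ∈ Ioo a b := by
  have hne := mt (h.abs_eq_two_iff hx).mpr hx₂.ne
  push Not at hne
  exact ⟨hx.1.lt_of_ne hne.1.symm, hx.2.lt_of_ne hne.2⟩

theorem left_le (h : IsBand f a b) (h' : IsBand f a' b') (hlt : a' < b) : a' ≤ a :=
  not_lt.mp fun ha => (h.abs_lt a' ⟨ha, hlt⟩).ne h'.abs_left

theorem right_le (h : IsBand f a b) (h' : IsBand f a' b') (hlt : a < b') : b ≤ b' :=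
  not_lt.mp fun hb => (h.abs_lt b' ⟨hlt, hb⟩).ne h'.abs_right

theorem eq_of_mem (h : IsBand f a b) (h' : IsBand f a' b') (hx : x ∈ Ioo a b)
    (hx' : x ∈ Ioo a' b') : a = a' ∧ b = b' :=
  have hab' := hx.1.trans hx'.2
  have ha'b := hx'.1.trans hx.2
  ⟨(h'.left_le h hab').antisymm (h.left_le h' ha'b),
    (h.right_le h' hab').antisymm (h'.right_le h ha'b)⟩

theorem injOn (h : IsBand f a b) (hf : RealLevels f) (hdeg : 0 < f.degree) :
    InjOn (fun x => f.eval x) (Icc a b) := by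
  intro x hx y hy heq
  by_contra! hne
  wlog hxy : x < y generalizing x y
  · exact this hy hx heq.symm hne.symm (hne.lt_of_le' (not_lt.mp hxy))
  obtain ⟨c, hc, hc'⟩ := exists_hasDerivAt_eq_zero hxy f.continuous.continuousOn heq
    fun z _ => f.hasDerivAt z
  exact (hf.two_le_abs_of_derivative_eq_zero hdeg hc').not_gt
    (h.abs_lt c ⟨hx.1.trans_lt hc.1, hc.2.trans_le hy.2⟩)

theorem eval_left (h : IsBand f a b) (hf : RealLevels f) (hdeg : 0 < f.degree) :
    f.eval a = -f.eval b :=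
  (abs_eq_abs.mp (h.abs_left.trans h.abs_right.symm)).resolve_left fun heq =>
    h.lt.ne (h.injOn hf hdeg (left_mem_Icc.mpr h.lt.le) (right_mem_Icc.mpr h.lt.le) heq)

theorem exists_eval_eq (h : IsBand f a b) (hf : RealLevels f) (hdeg : 0 < f.degree) {t : ℝ}
    (ht : |t| < 2) : ∃ x ∈ Ioo a b, f.eval x = t := by
  have hmem : t ∈ uIcc (f.eval a) (f.eval b) := by
    obtain ⟨hlo, hhi⟩ := _root_.abs_lt.mp ht
    rw [h.eval_left hf hdeg, mem_uIcc]
    rcases eq_or_eq_neg_of_abs_eq h.abs_right with hb | hb <;> rw [hb]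
    · exact Or.inl ⟨hlo.le, hhi.le⟩
    · exact Or.inr ⟨hlo.le, by linarith⟩
  obtain ⟨x, hx, rfl⟩ := intermediate_value_uIcc f.continuous.continuousOn hmem
  exact ⟨x, h.mem_Ioo (uIcc_of_le h.lt.le ▸ hx) ht, rfl⟩

theorem right_le_left (h : IsBand f a b) (h' : IsBand f a' b') (hf : RealLevels f)
    (hdeg : 0 < f.degree) {y : ℝ} (hx : x ∈ Ioo a b) (hy : y ∈ Ioo a' b') (hxy : x < y)
    (heq : f.eval x = f.eval y) : b ≤ a' := by
  by_contra! hlt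
  have hyb : y < b := hy.2.trans_le (h'.right_le h hlt)
  exact hxy.ne (h.injOn hf hdeg ⟨hx.1.le, hx.2.le⟩ ⟨(hx.1.trans hxy).le, hyb.le⟩ heq)

end IsBand

/-- `[a j, b j]`, `1 ≤ j ≤ p`, are the bands of `f` in increasing order. -/
structure IsBandSystem (f : ℝ[X]) (p : ℕ) (a b : ℕ → ℝ) : Prop where
  isBand : ∀ j, 1 ≤ j → j ≤ p → IsBand f (a j) (b j)
  le : ∀ j, 1 ≤ j → j < p → b j ≤ a (j + 1)
  cover : ∀ x, |f.eval x| ≤ 2 → ∃ j, 1 ≤ j ∧ j ≤ p ∧ x ∈ Icc (a j) (b j)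

theorem exists_strictMonoOn_image_eq {α : Type*} [LinearOrder α] [Nonempty α] (s : Finset α) :
    ∃ e : ℕ → α, StrictMonoOn e (Icc 1 s.card) ∧ e '' Icc 1 s.card = s := by
  let succ : Fin s.card → ℕ := fun i => i + 1
  have hsucc : Function.Injective succ := (add_left_injective 1).comp Fin.val_injective
  have hIcc : Icc 1 s.card = range succ := by
    ext j
    exact ⟨fun hj => ⟨⟨j - 1, by grind⟩, by grind⟩, by rintro ⟨i, rfl⟩; grind⟩
  set emb := s.orderEmbOfFin rfl
  refine ⟨Function.extend succ emb fun _ => Classical.arbitrary α, ?_, ?_⟩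
  · rw [hIcc]
    rintro _ ⟨i, rfl⟩ _ ⟨j, rfl⟩ hij
    rw [hsucc.extend_apply, hsucc.extend_apply]
    exact emb.strictMono (Nat.succ_lt_succ_iff.mp hij)
  · rw [hIcc, ← range_comp, Function.extend_comp hsucc, s.range_orderEmbOfFin]

theorem RealLevels.exists_isBandSystem {f : ℝ[X]} (hf : RealLevels f) (hdeg : 0 < f.degree) :
    ∃ a b, IsBandSystem f f.natDegree a b := by
  obtain ⟨e, he, himage⟩ := exists_strictMonoOn_image_eq f.roots.toFinset
  rw [hf.card_roots_toFinset hdeg] at he himage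
  have hzero : ∀ x, f.eval x = 0 ↔ ∃ j ∈ Icc 1 f.natDegree, e j = x := fun x => by
    rw [← mem_image, himage, Finset.mem_coe, Multiset.mem_toFinset,
      mem_roots (ne_zero_of_degree_gt hdeg), IsRoot.def]
  have he₀ : ∀ j ∈ Icc 1 f.natDegree, f.eval (e j) = 0 := fun j hj => (hzero _).mpr ⟨j, hj, rfl⟩
  have hband : ∀ j, ∃ a b, j ∈ Icc 1 f.natDegree → IsBand f a b ∧ e j ∈ Ioo a b := fun j => by
    by_cases hj : j ∈ Icc 1 f.natDegree
    · obtain ⟨a, b, h⟩ := exists_isBand hdeg (y := e j) (by rw [he₀ j hj]; norm_num)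
      exact ⟨a, b, fun _ => h⟩
    · exact ⟨0, 0, fun h => absurd h hj⟩
  choose a b hband using hband
  have hopen : {x | |f.eval x| < 2} ⊆ ⋃ j ∈ Icc 1 f.natDegree, Icc (a j) (b j) := by
    intro x hx
    obtain ⟨α, β, hαβ, hxαβ⟩ := exists_isBand hdeg hx
    obtain ⟨c, hc, hc₀⟩ := hαβ.exists_eval_eq hf hdeg (t := 0) (by norm_num)
    obtain ⟨j, hj, rfl⟩ := (hzero c).mp hc₀
    obtain ⟨rfl, rfl⟩ := hαβ.eq_of_mem (hband j hj).1 hc (hband j hj).2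
    exact mem_biUnion hj (Ioo_subset_Icc_self hxαβ)
  have hclosed : IsClosed (⋃ j ∈ Icc 1 f.natDegree, Icc (a j) (b j)) :=
    (finite_Icc 1 f.natDegree).isClosed_biUnion fun j _ => isClosed_Icc
  refine ⟨a, b, fun j h₁ h₂ => (hband j ⟨h₁, h₂⟩).1, fun j h₁ h₂ => ?_, fun x hx => ?_⟩
  · have hj : j ∈ Icc 1 f.natDegree := ⟨h₁, h₂.le⟩
    have hj' : j + 1 ∈ Icc 1 f.natDegree := ⟨by omega, h₂⟩
    exact (hband j hj).1.right_le_left (hband _ hj').1 hf hdeg (hband j hj).2 (hband _ hj').2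
      (he hj hj' j.lt_succ_self) ((he₀ j hj).trans (he₀ _ hj').symm)
  · obtain ⟨j, hj, hxj⟩ := mem_iUnion₂.mp
      (closure_minimal hopen hclosed (hf.mem_closure_abs_lt hdeg hx))
    exact ⟨j, hj.1, hj.2, hxj⟩

namespace IsBandSystem

variable {f : ℝ[X]} {p : ℕ} {a b : ℕ → ℝ} {x : ℝ}

theorem abs_le_iff (h : IsBandSystem f p a b) (x : ℝ) :
    |f.eval x| ≤ 2 ↔ ∃ j, 1 ≤ j ∧ j ≤ p ∧ x ∈ Icc (a j) (b j) :=
  ⟨h.cover x, fun ⟨j, h₁, h₂, hx⟩ => (h.isBand j h₁ h₂).abs_le hx⟩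

theorem exists_mem_Ioo (h : IsBandSystem f p a b) (hx : |f.eval x| < 2) :
    ∃ j, 1 ≤ j ∧ j ≤ p ∧ x ∈ Ioo (a j) (b j) :=
  have ⟨j, h₁, h₂, hxj⟩ := h.cover x hx.le
  ⟨j, h₁, h₂, (h.isBand j h₁ h₂).mem_Ioo hxj hx⟩

theorem right_le_left (h : IsBandSystem f p a b) {i j : ℕ} (hi : 1 ≤ i) (hij : i < j)
    (hj : j ≤ p) : b i ≤ a j := by
  induction j, hij using Nat.le_induction with
  | base => exact h.le i hi hj
  | succ j hij ih =>
    exact (ih (by omega)).trans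
      ((h.isBand j (by omega) (by omega)).lt.le.trans (h.le j (by omega) hj))

theorem left_mono (h : IsBandSystem f p a b) {i j : ℕ} (hi : 1 ≤ i) (hij : i ≤ j) (hj : j ≤ p) :
    a i ≤ a j := by
  rcases hij.eq_or_lt with rfl | hlt
  · rfl
  · exact (h.isBand i hi (hij.trans hj)).lt.le.trans (h.right_le_left hi hlt hj)

theorem right_mono (h : IsBandSystem f p a b) {i j : ℕ} (hi : 1 ≤ i) (hij : i ≤ j)
    (hj : j ≤ p) : b i ≤ b j := by
  rcases hij.eq_or_lt with rfl | hlt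
  · rfl
  · exact (h.right_le_left hi hlt hj).trans (h.isBand j (hi.trans hij) hj).lt.le

theorem eval_left_succ (h : IsBandSystem f p a b) {j : ℕ} (h₁ : 1 ≤ j) (h₂ : j < p) :
    f.eval (a (j + 1)) = f.eval (b j) := by
  have hb := (h.isBand j h₁ h₂.le).abs_right
  have ha := (h.isBand (j + 1) (by omega) h₂).abs_left
  refine (abs_eq_abs.mp (ha.trans hb.symm)).resolve_right fun hneg => ?_
  -- Opposite values would force a zero strictly between two consecutive bands.
  have hmem : (0 : ℝ) ∈ uIcc (f.eval (b j)) (f.eval (a (j + 1))) := by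
    rw [hneg, mem_uIcc]
    rcases le_total 0 (f.eval (b j)) with h₀ | h₀
    · exact Or.inr ⟨neg_nonpos.mpr h₀, h₀⟩
    · exact Or.inl ⟨h₀, neg_nonneg.mpr h₀⟩
  obtain ⟨c, hc, hc₀⟩ := intermediate_value_uIcc f.continuous.continuousOn hmem
  rw [uIcc_of_le (h.le j h₁ h₂)] at hc
  obtain ⟨i, hi₁, hi₂, hi⟩ := h.exists_mem_Ioo (x := c) (by norm_num [hc₀])
  rcases le_or_gt i j with hij | hij
  · exact (hi.2.trans_le (h.right_mono hi₁ hij h₂.le)).not_ge hc.1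
  · exact ((h.left_mono (by omega) hij hi₂).trans_lt hi.1).not_ge hc.2

theorem eval_right_last (h : IsBandSystem f p a b) (hp : 0 < p) (hdeg : 0 < f.degree)
    (hlead : 0 ≤ f.leadingCoeff) : f.eval (b p) = 2 := by
  refine (eq_or_eq_neg_of_abs_eq (h.isBand p hp le_rfl).abs_right).resolve_right fun hneg => ?_
  have hT := f.tendsto_atTop_of_leadingCoeff_nonneg hdeg hlead
  obtain ⟨z, hz, hbz⟩ := ((hT.eventually_ge_atTop 0).and (eventually_ge_atTop (b p))).exists
  obtain ⟨c, hc, hc₀⟩ := intermediate_value_Icc hbz f.continuous.continuousOn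
    (show (0 : ℝ) ∈ Icc _ _ from ⟨by rw [hneg]; norm_num, hz⟩)
  obtain ⟨i, hi₁, hi₂, hi⟩ := h.exists_mem_Ioo (x := c) (by norm_num [hc₀])
  exact (hi.2.trans_le (h.right_mono hi₁ hi₂ le_rfl)).not_ge hc.1

theorem eval_right (h : IsBandSystem f p a b) (hf : RealLevels f) (hdeg : 0 < f.degree)
    (hlead : 0 ≤ f.leadingCoeff) {i : ℕ} (hi : i < p) : f.eval (b (p - i)) = 2 * (-1) ^ i := by
  induction i with
  | zero => simpa using h.eval_right_last hi hdeg hlead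
  | succ i ih =>
    have hsucc : p - i = p - (i + 1) + 1 := by omega
    rw [← h.eval_left_succ (by omega) (by omega), ← hsucc,
      (h.isBand (p - i) (by omega) (by omega)).eval_left hf hdeg, ih (by omega)]
    ring

theorem strictMonoOn (h : IsBandSystem f p a b) (hf : RealLevels f) (hdeg : 0 < f.degree)
    (hlead : 0 ≤ f.leadingCoeff) {j : ℕ} (h₁ : 1 ≤ j) (h₂ : j ≤ p) (heven : Even (p - j)) :
    StrictMonoOn (fun x => f.eval x) (Icc (a j) (b j)) := by
  have hj := h.isBand j h₁ h₂
  have hright := h.eval_right hf hdeg hlead (i := p - j) (by omega)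
  rw [Nat.sub_sub_self h₂, heven.neg_one_pow] at hright
  refine (f.continuous.continuousOn.strictMonoOn_of_injOn_Icc' hj.lt.le
    (hj.injOn hf hdeg)).resolve_right fun hanti => ?_
  have hlt := hanti (left_mem_Icc.mpr hj.lt.le) (right_mem_Icc.mpr hj.lt.le) hj.lt
  simp only [hj.eval_left hf hdeg] at hlt
  linarith

theorem strictAntiOn (h : IsBandSystem f p a b) (hf : RealLevels f) (hdeg : 0 < f.degree)
    (hlead : 0 ≤ f.leadingCoeff) {j : ℕ} (h₁ : 1 ≤ j) (h₂ : j ≤ p) (hodd : Odd (p - j)) :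
    StrictAntiOn (fun x => f.eval x) (Icc (a j) (b j)) := by
  have hj := h.isBand j h₁ h₂
  have hright := h.eval_right hf hdeg hlead (i := p - j) (by omega)
  rw [Nat.sub_sub_self h₂, hodd.neg_one_pow] at hright
  refine (f.continuous.continuousOn.strictMonoOn_of_injOn_Icc' hj.lt.le
    (hj.injOn hf hdeg)).resolve_left fun hmono => ?_
  have hlt := hmono (left_mem_Icc.mpr hj.lt.le) (right_mem_Icc.mpr hj.lt.le) hj.lt
  simp only [hj.eval_left hf hdeg] at hlt
  linarith

end IsBandSystem

end RealLevels

section Operator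

theorem transfer_eq (V : ℤ → ℝ) (E : ℝ) (n : ℕ) :
    transfer V E n = !![sol (fun k => E - V k) 0 1 (n + 1), sol (fun k => E - V k) 1 0 (n + 1);
      sol (fun k => E - V k) 0 1 n, sol (fun k => E - V k) 1 0 n] := by
  induction n with
  | zero => simp [transfer, Matrix.one_fin_two]
  | succ n ih => simp [transfer, ih, sol_add_two, sub_eq_add_neg]

theorem discriminant_eq (p : ℕ) (V : ℤ → ℝ) (E : ℝ) :
    discriminant p V E = trace (fun k => E - V k) p := by
  rw [discriminant, transfer_eq, Matrix.trace_fin_two_of, trace]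

theorem inner_shift_left (k : ℤ) (u v : L2Z) :
    inner ℂ (shift k u) v = inner ℂ u (shift (-k) v) := by
  rw [lp.inner_eq_tsum, lp.inner_eq_tsum, ← (Equiv.addRight k).tsum_eq
    (fun n : ℤ => inner ℂ (u n) (shift (-k) v n))]
  simp

theorem inner_potential_left (V : ℤ → ℝ) (hV : ∃ C, ∀ n, |V n| ≤ C) (u v : L2Z) :
    inner ℂ (potential V hV u) v = inner ℂ u (potential V hV v) := by
  rw [lp.inner_eq_tsum, lp.inner_eq_tsum]
  refine tsum_congr fun n => ?_
  simp only [potential_apply, RCLike.inner_apply, map_mul, Complex.conj_ofReal]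
  ring

theorem isSelfAdjoint_jacobi (V : ℤ → ℝ) (hV : ∃ C, ∀ n, |V n| ≤ C) :
    IsSelfAdjoint (jacobi V hV) := by
  rw [ContinuousLinearMap.isSelfAdjoint_iff_isSymmetric]
  intro u v
  change inner ℂ (shift 1 u + shift (-1) u + potential V hV u) v =
    inner ℂ u (shift 1 v + shift (-1) v + potential V hV v)
  simp only [inner_add_left, inner_add_right, inner_shift_left, inner_potential_left, neg_neg]
  ring

theorem norm_shift_le (k : ℤ) : ‖shift k‖ ≤ 1 :=
  (shift k).opNorm_le_bound zero_le_one fun u => by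
    have h2 : 0 < (2 : ENNReal).toReal := by norm_num
    rw [one_mul, lp.norm_eq_tsum_rpow h2, lp.norm_eq_tsum_rpow h2]
    exact le_of_eq (congrArg (· ^ _) ((Equiv.addRight k).tsum_eq
      (fun n : ℤ => ‖u n‖ ^ (2 : ENNReal).toReal)))

theorem isUnit_shift_add_shift_neg_sub (k : ℤ) {z : ℂ} (hz : 2 < ‖z‖) :
    IsUnit (shift k + shift (-k) - z • 1) := by
  have hnorm : ‖shift k + shift (-k)‖ ≤ 2 := by
    linarith [norm_add_le (shift k) (shift (-k)), norm_shift_le k, norm_shift_le (-k)]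
  have hres : z ∈ resolventSet ℂ (shift k + shift (-k)) :=
    spectrum.mem_resolventSet_of_norm_lt_mul <|
      (mul_le_of_le_one_right (norm_nonneg _) ContinuousLinearMap.norm_id_le).trans_lt
        (hnorm.trans_lt hz)
  rw [← IsUnit.neg_iff, neg_sub, ← Algebra.algebraMap_eq_smul_one]
  exact hres

theorem isUnit_of_isSelfAdjoint_of_mul_eq_one {R : Type*} [Monoid R] [StarMul R] {a b : R}
    (ha : IsSelfAdjoint a) (hba : b * a = 1) : IsUnit a := by
  have hab : a * star b = 1 := by simpa [ha.star_eq] using congrArg star hba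
  exact ⟨⟨a, b, by rwa [left_inv_eq_right_inv hba hab], hba⟩, rfl⟩

/-- The coefficients `E - V (m + k)` of the eigenvalue recurrence read off from the site `m`. -/
def coeff (V : ℤ → ℝ) (E : ℝ) (m : ℤ) (k : ℕ) : ℝ := E - V (m + k)

theorem coeff_add_nat (V : ℤ → ℝ) (E : ℝ) (m : ℤ) (i k : ℕ) :
    coeff V E (m + i) k = coeff V E m (k + i) := by
  simp only [coeff, Nat.cast_add, add_assoc, add_comm (i : ℤ)]

variable {p : ℕ} {V : ℤ → ℝ}

theorem coeff_periodic (hV : Function.Periodic V (p : ℤ)) (E : ℝ) :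
    Function.Periodic (coeff V E) (p : ℤ) := fun m => funext fun k => by
  rw [coeff, coeff, add_right_comm, hV]

theorem trace_coeff (hp : 0 < p) (hV : Function.Periodic V (p : ℤ)) (E : ℝ) (m : ℤ) :
    trace (coeff V E m) p = discriminant p V E := by
  have hstep (m : ℤ) : trace (coeff V E (m + 1)) p = trace (coeff V E m) p := by
    rw [← trace_shift hp (w := coeff V E m)]
    · exact congrArg (trace · p) (funext (coeff_add_nat V E m 1))
    · rw [add_comm p, ← coeff_add_nat, coeff_periodic hV]
  induction m using Int.induction_on with
  | zero =>
    rw [discriminant_eq]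
    exact congrArg (trace · p) (funext fun k => by rw [coeff, zero_add])
  | succ i ih => rw [hstep, ih]
  | pred i ih => rw [← ih, ← hstep, sub_add_cancel]

theorem sol_coeff_periodic (hV : Function.Periodic V (p : ℤ)) (E x y : ℝ) (n : ℕ) :
    Function.Periodic (fun m : ℤ => sol (coeff V E m) x y n) (p : ℤ) :=
  (coeff_periodic hV E).comp fun w => sol w x y n

/-- Multiplication on `ℓ²(ℤ)` by the value at distance `n` of a solution of the eigenvalue
equation, as a function of the site at which the solution starts. -/
def solOp (hp : 0 < p) (hV : Function.Periodic V (p : ℤ)) (E x y : ℝ) (n : ℕ) : L2Z →L[ℂ] L2Z :=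
  potential (fun m : ℤ => sol (coeff V E m) x y n)
    (bounded_of_periodic hp (sol_coeff_periodic hV E x y n))

theorem solOp_apply (hp : 0 < p) (hV : Function.Periodic V (p : ℤ)) (E x y : ℝ) (n : ℕ)
    (u : L2Z) (m : ℤ) :
    solOp hp hV E x y n u m = ((sol (coeff V E m) x y n : ℝ) : ℂ) * u m := rfl

-- Modulo the left ideal of `H - E`, every `u` solves the eigenvalue equation.
theorem shift_sub_mem_span (hp : 0 < p) (hV : Function.Periodic V (p : ℤ)) (E : ℝ) (n : ℕ) :
    shift n - (solOp hp hV E 0 1 n * shift 1 + solOp hp hV E 1 0 n) ∈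
      Ideal.span {jacobi V (bounded_of_periodic hp hV) - (E : ℂ) • 1} := by
  set K := jacobi V (bounded_of_periodic hp hV) - (E : ℂ) • 1 with hK
  induction n using Nat.twoStepInduction with
  | zero =>
    convert Submodule.zero_mem _
    ext u m
    simp [solOp_apply]
  | one =>
    convert Submodule.zero_mem _
    ext u m
    simp [solOp_apply]
  | more n ih₀ ih₁ =>
    have hc : Function.Periodic (fun m : ℤ => coeff V E m (n + 1)) (p : ℤ) :=
      (coeff_periodic hV E).comp fun w => w (n + 1)
    have hrec : shift (n + 2 : ℕ) -
        (solOp hp hV E 0 1 (n + 2) * shift 1 + solOp hp hV E 1 0 (n + 2)) =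
        shift (n + 1 : ℕ) * K + potential _ (bounded_of_periodic hp hc) *
          (shift (n + 1 : ℕ) - (solOp hp hV E 0 1 (n + 1) * shift 1 + solOp hp hV E 1 0 (n + 1)))
        - (shift n - (solOp hp hV E 0 1 n * shift 1 + solOp hp hV E 1 0 n)) := by
      ext u m
      have hadd : m + ((n + 1 : ℕ) : ℤ) + 1 = m + ((n + 2 : ℕ) : ℤ) := by push_cast; ring
      have hsub : m + ((n + 1 : ℕ) : ℤ) - 1 = m + (n : ℤ) := by push_cast; ring
      simp only [hK, _root_.sub_apply, _root_.add_apply, mul_apply_eq_comp, _root_.smul_apply,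
        one_apply_eq_self, lp.coeFn_sub, lp.coeFn_add, lp.coeFn_smul, Pi.sub_apply,
        Pi.add_apply, Pi.smul_apply, shift_apply, potential_apply, jacobi_apply, solOp_apply,
        sol_add_two, smul_eq_mul, hadd, hsub]
      simp only [coeff]
      push_cast
      ring
    rw [hrec]
    exact Submodule.sub_mem _ (Submodule.add_mem _
      (Ideal.mul_mem_left _ _ (Ideal.subset_span rfl)) (Ideal.mul_mem_left _ _ ih₁)) ih₀

theorem shift_add_shift_neg_sub_mem_span (hp : 0 < p) (hV : Function.Periodic V (p : ℤ)) (E : ℝ) :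
    shift p + shift (-p) - (discriminant p V E : ℂ) • 1 ∈
      Ideal.span {jacobi V (bounded_of_periodic hp hV) - (E : ℂ) • 1} := by
  have hmem₀ := shift_sub_mem_span hp hV E p
  have hmem₁ := shift_sub_mem_span hp hV E (p + 1)
  have hcomb : shift p + shift (-p) - (discriminant p V E : ℂ) • 1 =
      (shift p - (solOp hp hV E 0 1 p * shift 1 + solOp hp hV E 1 0 p)) -
      (solOp hp hV E 0 1 (p + 1) * (shift (-p) *
          (shift p - (solOp hp hV E 0 1 p * shift 1 + solOp hp hV E 1 0 p))) -
        solOp hp hV E 0 1 p * (shift (-p) * (shift (p + 1 : ℕ) -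
          (solOp hp hV E 0 1 (p + 1) * shift 1 + solOp hp hV E 1 0 (p + 1))))) := by
    ext u m
    have hsucc : m + (-p : ℤ) + ((p + 1 : ℕ) : ℤ) = m + 1 := by push_cast; ring
    have hback : m + (-p : ℤ) + (p : ℤ) = m := by ring
    have hc : coeff V E (m + (-p : ℤ)) = coeff V E m := (coeff_periodic hV E).neg m
    have hdet := congrArg Complex.ofReal (sol_casoratian (coeff V E m) p)
    rw [← trace_coeff hp hV E m]
    simp only [_root_.sub_apply, _root_.add_apply, mul_apply_eq_comp, _root_.smul_apply,
      one_apply_eq_self, lp.coeFn_sub, lp.coeFn_add, lp.coeFn_smul, Pi.sub_apply,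
      Pi.add_apply, Pi.smul_apply, shift_apply, solOp_apply, smul_eq_mul, hsucc, hback, hc, trace]
    push_cast at hdet ⊢
    linear_combination -u (m + (-p : ℤ)) * hdet
  rw [hcomb]
  exact Submodule.sub_mem _ hmem₀ (Submodule.sub_mem _
    (Ideal.mul_mem_left _ _ (Ideal.mul_mem_left _ _ hmem₀))
    (Ideal.mul_mem_left _ _ (Ideal.mul_mem_left _ _ hmem₁)))

theorem abs_discriminant_le_of_mem_spectrum (hp : 0 < p) (hV : Function.Periodic V (p : ℤ))
    {E : ℝ} (hE : (E : ℂ) ∈ spectrum ℂ (jacobi V (bounded_of_periodic hp hV))) :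
    |discriminant p V E| ≤ 2 := by
  by_contra! hlt
  have hu : IsUnit (shift p + shift (-p) - (discriminant p V E : ℂ) • 1) :=
    isUnit_shift_add_shift_neg_sub p (by rwa [Complex.norm_real])
  have htop := Ideal.eq_top_of_isUnit_mem _ (shift_add_shift_neg_sub_mem_span hp hV E) hu
  obtain ⟨B, hB⟩ := Ideal.mem_span_singleton'.mp ((Ideal.eq_top_iff_one _).mp htop)
  have hself : IsSelfAdjoint (jacobi V (bounded_of_periodic hp hV) - (E : ℂ) • 1) :=
    (isSelfAdjoint_jacobi V _).sub (IsSelfAdjoint.smul (Complex.conj_ofReal E) (.one _))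
  apply hE
  rw [spectrum.mem_resolventSet_iff, ← IsUnit.neg_iff, neg_sub, Algebra.algebraMap_eq_smul_one]
  exact isUnit_of_isSelfAdjoint_of_mul_eq_one hself hB

theorem jacobi_single (V : ℤ → ℝ) (hV : ∃ C, ∀ n, |V n| ≤ C) (n : ℤ) (x : ℂ) :
    jacobi V hV (lp.single 2 n x) =
      lp.single 2 (n - 1) x + lp.single 2 (n + 1) x + lp.single 2 n ((V n : ℂ) * x) := by
  ext m
  simp only [jacobi_apply, lp.coeFn_add, Pi.add_apply, lp.single_apply, Pi.single_apply]
  rcases eq_or_ne m n with rfl | hne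
  · simp [show m ≠ m - 1 by omega]
  · simp [hne, eq_sub_iff_add_eq, sub_eq_iff_eq_add]

/-- The sequence `u`, cut off to the sites `1, …, N` and extended by zero to `ℤ`; these are the
trial vectors for energies in the spectrum. -/
def truncation (u : ℕ → ℂ) (N : ℕ) : L2Z := ∑ n ∈ Finset.Ico 1 (N + 1), lp.single 2 (n : ℤ) (u n)

theorem norm_truncation_sq (u : ℕ → ℂ) (N : ℕ) :
    ‖truncation u N‖ ^ 2 = ∑ n ∈ Finset.range N, ‖u (n + 1)‖ ^ 2 := by
  have h := lp.norm_sum_single (E := fun _ : ℤ => ℂ) (p := 2) (by norm_num)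
    (fun n : ℤ => u n.toNat) ((Finset.Ico 1 (N + 1)).map Nat.castEmbedding)
  simp only [Finset.sum_map, Nat.castEmbedding_apply, Int.toNat_natCast, ENNReal.toReal_ofNat,
    Real.rpow_two, Finset.sum_Ico_eq_sum_range _ 1, Nat.add_sub_cancel, add_comm 1] at h
  simpa only [truncation, Finset.sum_Ico_eq_sum_range _ 1, Nat.add_sub_cancel, add_comm 1] using h

variable (V) in
theorem jacobi_truncation (hV : ∃ C, ∀ n, |V n| ≤ C) (z : ℂ) {u : ℕ → ℂ}
    (hu : ∀ n, u (n + 2) = (z - V ((n + 1 : ℕ) : ℤ)) * u (n + 1) - u n) (N : ℕ) :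
    (algebraMap ℂ _ z - jacobi V hV) (truncation u N) =
      lp.single 2 (1 : ℤ) (u 0) - lp.single 2 (0 : ℤ) (u 1) +
        lp.single 2 (N : ℤ) (u (N + 1)) - lp.single 2 ((N : ℤ) + 1) (u N) := by
  rw [Algebra.algebraMap_eq_smul_one]
  induction N with
  | zero => simp [truncation]
  | succ N ih =>
    have hpred : ((N + 1 : ℕ) : ℤ) - 1 = N := by push_cast; ring
    have hsingle : lp.single 2 ((N + 1 : ℕ) : ℤ) (u (N + 2)) =
        (lp.single 2 ((N + 1 : ℕ) : ℤ) (z * u (N + 1)) : L2Z) -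
        lp.single 2 ((N + 1 : ℕ) : ℤ) ((V ((N + 1 : ℕ) : ℤ) : ℂ) * u (N + 1)) -
          lp.single 2 ((N + 1 : ℕ) : ℤ) (u N) := by
      rw [← lp.single_sub, ← lp.single_sub, hu, sub_mul]
    have hsucc : truncation u (N + 1) =
        truncation u N + lp.single 2 ((N + 1 : ℕ) : ℤ) (u (N + 1)) :=
      Finset.sum_Ico_succ_top (by omega) _
    rw [hsucc, map_add, ih]
    simp only [_root_.sub_apply, _root_.smul_apply, one_apply_eq_self, jacobi_single, hpred,
      ← lp.single_smul, smul_eq_mul]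
    rw [show N + 1 + 1 = N + 2 by ring, hsingle]
    push_cast
    abel

theorem norm_jacobi_truncation_le (hV : ∃ C, ∀ n, |V n| ≤ C) (z : ℂ) {u : ℕ → ℂ}
    (hu : ∀ n, u (n + 2) = (z - V ((n + 1 : ℕ) : ℤ)) * u (n + 1) - u n)
    {B : ℝ} (hB : ∀ n, ‖u n‖ ≤ B) (N : ℕ) :
    ‖(algebraMap ℂ _ z - jacobi V hV) (truncation u N)‖ ≤ B + B + B + B := by
  have hsingle (m : ℤ) (n : ℕ) : ‖(lp.single 2 m (u n) : L2Z)‖ ≤ B := by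
    rw [lp.norm_single (by norm_num)]
    exact hB n
  rw [jacobi_truncation V hV z hu N]
  exact norm_sub_le_of_le (norm_add_le_of_le (norm_sub_le_of_le (hsingle _ _) (hsingle _ _))
    (hsingle _ _)) (hsingle _ _)

-- If `z` were in the resolvent set, the truncations would be bounded, so `u` would be in `ℓ²`.
theorem mem_spectrum_of_bounded_solution (hV : ∃ C, ∀ n, |V n| ≤ C) (z : ℂ)
    {u : ℕ → ℂ} (hu : ∀ n, u (n + 2) = (z - V ((n + 1 : ℕ) : ℤ)) * u (n + 1) - u n)
    {B : ℝ} (hB : ∀ n, ‖u n‖ ≤ B) (hne : ¬ Tendsto u atTop (𝓝 0)) :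
    z ∈ spectrum ℂ (jacobi V hV) := by
  rintro ⟨K, hK⟩
  set C := ‖(↑K⁻¹ : L2Z →L[ℂ] L2Z)‖ * (B + B + B + B)
  have hbound (N : ℕ) : ‖truncation u N‖ ≤ C := by
    have hinv : truncation u N =
        (↑K⁻¹ : L2Z →L[ℂ] L2Z) ((K : L2Z →L[ℂ] L2Z) (truncation u N)) := by
      rw [← mul_apply_eq_comp, Units.inv_mul, one_apply_eq_self]
    rw [hinv, hK]
    exact ContinuousLinearMap.le_opNorm_of_le _ (norm_jacobi_truncation_le hV z hu hB N)
  have hsum : Summable fun n => ‖u (n + 1)‖ ^ 2 := by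
    refine summable_of_sum_range_le (c := C ^ 2) (fun n => by positivity) fun N => ?_
    rw [← norm_truncation_sq]
    exact pow_le_pow_left₀ (norm_nonneg _) (hbound N) 2
  apply hne
  rw [← tendsto_add_atTop_iff_nat 1, tendsto_zero_iff_norm_tendsto_zero]
  simpa using hsum.tendsto_atTop_zero.sqrt

theorem exists_norm_eq_one_of_abs_le_two {t : ℝ} (ht : |t| ≤ 2) :
    ∃ ζ : ℂ, ‖ζ‖ = 1 ∧ ζ ^ 2 - t * ζ + 1 = 0 := by
  obtain ⟨hlo, hhi⟩ := abs_le.mp ht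
  set φ := Real.arccos (t / 2) with hφ
  have hcos : t = 2 * Real.cos φ := by
    rw [hφ, Real.cos_arccos (by linarith) (by linarith)]
    ring
  refine ⟨Complex.exp (φ * Complex.I), Complex.norm_exp_ofReal_mul_I φ, ?_⟩
  rw [hcos, Complex.exp_mul_I]
  push_cast
  linear_combination Complex.sin φ ^ 2 * Complex.I_sq - Complex.sin_sq_add_cos_sq (φ : ℂ)

theorem exists_floquet {w : ℕ → ℂ} {t : ℝ} (hw : Function.Periodic w p)
    (ht : trace w p = t) (ht₂ : |t| ≤ 2) :
    ∃ x y ζ : ℂ, ‖ζ‖ = 1 ∧ (x ≠ 0 ∨ y ≠ 0) ∧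
      ∀ n, sol w x y (n + p) = ζ * sol w x y n := by
  obtain ⟨ζ, hζ, hquad⟩ := exists_norm_eq_one_of_abs_le_two ht₂
  have hdet : (!![sol w 1 0 p - ζ, sol w 0 1 p;
      sol w 1 0 (p + 1), sol w 0 1 (p + 1) - ζ]).det = 0 := by
    rw [Matrix.det_fin_two_of]
    rw [trace] at ht
    linear_combination hquad + sol_casoratian w p - ζ * ht
  obtain ⟨v, hv₀, hv⟩ := Matrix.exists_mulVec_eq_zero_iff.mpr hdet
  have hrow₀ := congrFun hv 0
  have hrow₁ := congrFun hv 1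
  simp only [Matrix.mulVec, dotProduct, Fin.sum_univ_two, Matrix.of_apply, Matrix.cons_val',
    Matrix.cons_val_zero, Matrix.cons_val_one, Matrix.cons_val_fin_one, Pi.zero_apply]
    at hrow₀ hrow₁
  refine ⟨v 0, v 1, ζ, hζ, ?_, fun n => ?_⟩
  · by_contra! h
    exact hv₀ (funext fun i => by fin_cases i; exacts [h.1, h.2])
  · have h₀ : sol w (v 0) (v 1) p = ζ * v 0 := by
      rw [sol_eq_linear]; linear_combination hrow₀
    have h₁ : sol w (v 0) (v 1) (p + 1) = ζ * v 1 := by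
      rw [sol_eq_linear]; linear_combination hrow₁
    rw [sol_add_period hw, h₀, h₁, sol_eq_linear w (v 0)]
    ring

theorem exists_forall_le_of_periodic {f : ℕ → ℝ} (hp : 0 < p) (hf : Function.Periodic f p) :
    ∃ B, ∀ n, f n ≤ B := by
  obtain ⟨B, hB⟩ := (Finset.range p).image f |>.bddAbove
  refine ⟨B, fun n => ?_⟩
  rw [← hf.map_mod_nat]
  exact hB (Finset.mem_coe.mpr (Finset.mem_image_of_mem f (Finset.mem_range.mpr (n.mod_lt hp))))

theorem eq_of_periodic_of_tendsto {α : Type*} [TopologicalSpace α] [T2Space α] {f : ℕ → α} {a : α}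
    (hp : 0 < p) (hf : Function.Periodic f p) (ha : Tendsto f atTop (𝓝 a)) (n : ℕ) : f n = a := by
  have hsub : Tendsto (fun m : ℕ => f (n + m * p)) atTop (𝓝 a) :=
    ha.comp <| tendsto_atTop_mono (fun m => (Nat.le_mul_of_pos_right m hp).trans
      (Nat.le_add_left _ n)) tendsto_id
  have hconst (m : ℕ) : f (n + m * p) = f n := hf.nat_mul m n
  simp only [hconst] at hsub
  exact tendsto_nhds_unique tendsto_const_nhds hsub

theorem mem_spectrum_of_trace (hp : 0 < p) (hV : Function.Periodic V (p : ℤ)) {z : ℂ} {t : ℝ}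
    (ht : trace (fun k => z - V k) p = t) (ht₂ : |t| ≤ 2) :
    z ∈ spectrum ℂ (jacobi V (bounded_of_periodic hp hV)) := by
  have hw : Function.Periodic (fun k : ℕ => z - V k) p := fun k => by
    push_cast; rw [hV]
  obtain ⟨x, y, ζ, hζ, hxy, hsol⟩ := exists_floquet hw ht ht₂
  set u := sol (fun k => z - V k) x y
  have hper : Function.Periodic (fun n => ‖u n‖) p := fun n => by
    simp only [hsol, norm_mul, hζ, one_mul]
  obtain ⟨B, hB⟩ := exists_forall_le_of_periodic hp hper
  refine mem_spectrum_of_bounded_solution _ z (sol_add_two _ x y) hB fun htend => ?_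
  have hzero (n : ℕ) : u n = 0 := norm_eq_zero.mp <|
    eq_of_periodic_of_tendsto hp hper (tendsto_zero_iff_norm_tendsto_zero.mp htend) n
  exact hxy.elim (fun hx => hx (hzero 0)) fun hy => hy (hzero 1)

theorem im_eq_zero_of_trace (hp : 0 < p) (hV : Function.Periodic V (p : ℤ)) {z : ℂ} {t : ℝ}
    (ht : trace (fun k => z - V k) p = t) (ht₂ : |t| ≤ 2) : z.im = 0 :=
  (isSelfAdjoint_jacobi V _).im_eq_zero_of_mem_spectrum (mem_spectrum_of_trace hp hV ht ht₂)

theorem spectrum_jacobi (hp : 0 < p) (hV : Function.Periodic V (p : ℤ)) :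
    spectrum ℂ (jacobi V (bounded_of_periodic hp hV)) =
      Complex.ofReal '' {E : ℝ | |discriminant p V E| ≤ 2} := by
  ext z
  constructor
  · intro hz
    have hre := (isSelfAdjoint_jacobi V _).mem_spectrum_eq_re hz
    rw [hre] at hz
    exact ⟨z.re, abs_discriminant_le_of_mem_spectrum hp hV hz, hre.symm⟩
  · rintro ⟨E, hE, rfl⟩
    have htrace : trace (fun k : ℕ => (E : ℂ) - V k) p = (discriminant p V E : ℂ) := by
      simpa [discriminant_eq] using (map_trace Complex.ofRealHom (fun k : ℕ => E - V k) p).symm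
    exact mem_spectrum_of_trace hp hV htrace hE

end Operator

section DiscriminantPolynomial

open Polynomial

variable {p : ℕ} {V : ℤ → ℝ} {a b : ℕ → ℝ}

/-- The discriminant `D` as a polynomial in the energy. -/
def discPoly (p : ℕ) (V : ℤ → ℝ) : ℝ[X] := trace (fun k : ℕ => X - C (V k)) p

theorem eval_discPoly (p : ℕ) (V : ℤ → ℝ) (E : ℝ) :
    (discPoly p V).eval E = discriminant p V E := by
  rw [discPoly, eval_trace (fun k : ℕ => V k), discriminant_eq]

theorem isMonicOfDegree_discPoly (hp : 0 < p) (V : ℤ → ℝ) : IsMonicOfDegree (discPoly p V) p :=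
  isMonicOfDegree_trace (fun k : ℕ => V k) hp

theorem degree_discPoly_pos (hp : 0 < p) (V : ℤ → ℝ) : 0 < (discPoly p V).degree :=
  natDegree_pos_iff_degree_pos.mp (by rwa [(isMonicOfDegree_discPoly hp V).natDegree_eq])

theorem leadingCoeff_discPoly_nonneg (hp : 0 < p) (V : ℤ → ℝ) :
    0 ≤ (discPoly p V).leadingCoeff := by
  rw [(isMonicOfDegree_discPoly hp V).monic.leadingCoeff]
  exact zero_le_one

theorem realLevels_discPoly (hp : 0 < p) (hV : Function.Periodic V (p : ℤ)) :
    RealLevels (discPoly p V) := fun t ht => by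
  refine Splits.of_splits_map Complex.ofRealHom (IsAlgClosed.splits _) fun z hz => ?_
  have htrace : trace (fun k : ℕ => z - V k) p = t := by
    have hmap := map_trace (eval₂RingHom Complex.ofRealHom z) (fun k : ℕ => X - C (V k)) p
    simp only [coe_eval₂RingHom, eval₂_sub, eval₂_X, eval₂_C, Complex.ofRealHom_eq_coe] at hmap
    have hroot := (mem_roots'.mp hz).2
    rw [IsRoot.def, eval_map, eval₂_sub, eval₂_C, sub_eq_zero] at hroot
    rw [← hmap]
    exact hroot
  exact ⟨z.re, Complex.ext rfl (im_eq_zero_of_trace hp hV htrace ht.le).symm⟩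

theorem isBands_iff_isBandSystem (hp : 0 < p) (hV : Function.Periodic V (p : ℤ)) :
    IsBands p V (bounded_of_periodic hp hV) a b ↔ IsBandSystem (discPoly p V) p a b := by
  have hspec : spectrum ℂ (jacobi V (bounded_of_periodic hp hV)) =
        Complex.ofReal '' {E : ℝ | ∃ j, 1 ≤ j ∧ j ≤ p ∧ E ∈ Icc (a j) (b j)} ↔
      ∀ x, |discriminant p V x| ≤ 2 ↔ ∃ j, 1 ≤ j ∧ j ≤ p ∧ x ∈ Icc (a j) (b j) := by
    rw [spectrum_jacobi hp hV, Complex.ofReal_injective.image_injective.eq_iff, Set.ext_iff]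
    rfl
  simp only [← eval_discPoly] at hspec
  constructor
  · intro h
    have hcover := hspec.mp h.spectrum_eq
    have hedge {j : ℕ} (h₁ : 1 ≤ j) (h₂ : j ≤ p) {x : ℝ} (hx : x ∈ Icc (a j) (b j)) :
        |(discPoly p V).eval x| = 2 ↔ x = a j ∨ x = b j := by
      rw [eval_discPoly, h.edge j h₁ h₂ x hx]
    refine ⟨fun j h₁ h₂ => ?_, h.le, fun x => (hcover x).mp⟩
    have hlt := h.lt j h₁ h₂
    refine ⟨hlt, (hedge h₁ h₂ (left_mem_Icc.mpr hlt.le)).mpr (.inl rfl),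
      (hedge h₁ h₂ (right_mem_Icc.mpr hlt.le)).mpr (.inr rfl), fun x hx => ?_⟩
    refine ((hcover x).mpr ⟨j, h₁, h₂, Ioo_subset_Icc_self hx⟩).lt_of_ne fun hx₂ => ?_
    rcases (hedge h₁ h₂ (Ioo_subset_Icc_self hx)).mp hx₂ with rfl | rfl
    exacts [hx.1.ne rfl, hx.2.ne rfl]
  · intro h
    refine ⟨fun j h₁ h₂ => (h.isBand j h₁ h₂).lt, h.le, hspec.mpr h.abs_le_iff,
      fun j h₁ h₂ E hE => ?_⟩
    rw [← eval_discPoly, (h.isBand j h₁ h₂).abs_eq_two_iff hE]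

theorem exists_isBands (hp : 0 < p) (hV : Function.Periodic V (p : ℤ)) :
    ∃ a b, IsBands p V (bounded_of_periodic hp hV) a b := by
  have h := (realLevels_discPoly hp hV).exists_isBandSystem (degree_discPoly_pos hp V)
  rw [(isMonicOfDegree_discPoly hp V).natDegree_eq] at h
  simpa only [isBands_iff_isBandSystem hp hV] using h

end DiscriminantPolynomial

section ZeroCounting

open Polynomial

/-- The number of distinct zeros of `f` in `(-∞, E]`. -/
def zeroCount (f : ℝ[X]) (E : ℝ) : ℕ := {x | f.eval x = 0 ∧ x ≤ E}.ncard

theorem finite_zeros {f : ℝ[X]} (hf : f ≠ 0) (E : ℝ) : {x | f.eval x = 0 ∧ x ≤ E}.Finite :=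
  (finite_setOfPred_isRoot hf).subset fun _ hx => hx.1

theorem exists_zero_between {f g : ℝ[X]} (h : ∀ x, (wronskian f g).eval x ≠ 0) {x y : ℝ}
    (hxy : x < y) (hx : f.eval x = 0) (hy : f.eval y = 0) : ∃ z ∈ Ioo x y, g.eval z = 0 := by
  -- Otherwise Rolle's theorem applies to `f / g`, whose derivative is a Wronskian over `g ^ 2`.
  by_contra! hne
  have hcommon : ∀ z, f.eval z = 0 → g.eval z ≠ 0 := fun z hf hg =>
    h z (by simp [wronskian, hf, hg])
  have hg : ∀ z ∈ Icc x y, g.eval z ≠ 0 := fun z hz => by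
    rcases eq_endpoints_or_mem_Ioo_of_mem_Icc hz with rfl | rfl | hz'
    exacts [hcommon z hx, hcommon z hy, hne z hz']
  obtain ⟨c, hc, hc₀⟩ := exists_hasDerivAt_eq_zero (f := fun z => f.eval z / g.eval z) hxy
    (f.continuous.continuousOn.div g.continuous.continuousOn hg) (by simp only [hx, hy, zero_div])
    fun z hz => (f.hasDerivAt z).div (g.hasDerivAt z) (hg z (Ioo_subset_Icc_self hz))
  rw [div_eq_zero_iff, or_iff_left (pow_ne_zero 2 (hg c (Ioo_subset_Icc_self hc)))] at hc₀
  refine h c ?_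
  rw [wronskian, eval_sub, eval_mul, eval_mul]
  linarith

theorem zeroCount_le_succ {f g : ℝ[X]} (h : ∀ x, (wronskian f g).eval x ≠ 0) (E : ℝ) :
    zeroCount f E ≤ zeroCount g E + 1 := by
  have hf : f ≠ 0 := by rintro rfl; simpa using h 0
  have hg : g ≠ 0 := by rintro rfl; simpa using h 0
  rw [zeroCount, zeroCount, ncard_eq_toFinset_card _ (finite_zeros hf E),
    ncard_eq_toFinset_card _ (finite_zeros hg E)]
  refine Finset.card_le_of_interleaved fun x hx y hy hxy _ => ?_
  rw [Finite.mem_toFinset] at hx hy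
  obtain ⟨z, hz, hgz⟩ := exists_zero_between h hxy hx.1 hy.1
  exact ⟨z, (Finite.mem_toFinset _).mpr ⟨hgz, hz.2.le.trans hy.2⟩, hz.1, hz.2⟩

theorem abs_zeroCount_sub_le_one {f g : ℝ[X]} (h : ∀ x, (wronskian f g).eval x ≠ 0) (E : ℝ) :
    |(zeroCount f E : ℝ) - zeroCount g E| ≤ 1 := by
  have hle := zeroCount_le_succ h E
  have hge := zeroCount_le_succ (f := g) (g := f)
    (fun x => by rw [← wronskian_neg_eq, eval_neg]; exact neg_ne_zero.mpr (h x)) E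
  rw [abs_sub_le_iff, sub_le_iff_le_add', sub_le_iff_le_add']
  exact ⟨by exact_mod_cast hle, by exact_mod_cast hge⟩

theorem abs_zeroCount_mul_sub_le {f g : ℝ[X]} (hfg : f * g ≠ 0) (E : ℝ) :
    |(zeroCount (f * g) E : ℝ) - zeroCount g E| ≤ zeroCount f E := by
  have hunion : {x | (f * g).eval x = 0 ∧ x ≤ E} =
      {x | f.eval x = 0 ∧ x ≤ E} ∪ {x | g.eval x = 0 ∧ x ≤ E} := by
    ext x
    simp only [eval_mul, mul_eq_zero, mem_union, mem_ofPred_eq]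
    tauto
  have hle : zeroCount (f * g) E ≤ zeroCount f E + zeroCount g E := by
    rw [zeroCount, hunion]
    exact ncard_union_le _ _
  have hge : zeroCount g E ≤ zeroCount (f * g) E :=
    ncard_le_ncard (by rw [hunion]; exact subset_union_right) (finite_zeros hfg E)
  have hnonneg : (0 : ℝ) ≤ zeroCount f E := Nat.cast_nonneg _
  rw [← @Nat.cast_le ℝ] at hle hge
  push_cast at hle
  rw [abs_sub_le_iff]
  constructor <;> linarith

end ZeroCounting

section BoundaryConditions

open Polynomial

variable (V : ℤ → ℝ)

/-- The value at `L` of the solution with `u 0 = x` and `u 1 = y`, as a polynomial in the energy.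
For `(x, y) = (cos θ, sin θ)` its zeros are the eigenvalues of `H_L`. -/
def boundaryPoly (x y : ℝ) (L : ℕ) : ℝ[X] := sol (fun k : ℕ => X - C (V k)) (C x) (C y) L

theorem eval_boundaryPoly (x y E : ℝ) (L : ℕ) :
    (boundaryPoly V x y L).eval E = sol (fun k : ℕ => E - V k) x y L :=
  eval_sol (fun k : ℕ => V k) x y E L

theorem boundaryPoly_zero_one (L : ℕ) :
    boundaryPoly V 0 1 L = sol (fun k : ℕ => X - C (V k)) 0 1 L := by
  rw [boundaryPoly, C_0, C_1]

theorem boundaryPoly_zero_one_ne_zero {L : ℕ} (hL : 0 < L) : boundaryPoly V 0 1 L ≠ 0 := by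
  obtain ⟨m, rfl⟩ : ∃ m, L = m + 1 := ⟨L - 1, by omega⟩
  rw [boundaryPoly_zero_one]
  exact (isMonicOfDegree_sol (fun k : ℕ => V k) m).ne_zero

theorem eval_boundaryPoly_of_mem_finiteSpectrum {θ E : ℝ} {L : ℕ}
    (hE : E ∈ finiteSpectrum V θ L) :
    (boundaryPoly V (Real.cos θ) (Real.sin θ) L).eval E = 0 := by
  obtain ⟨u, ⟨n, hn₁, hnL, hn⟩, hbc, huL, hrec⟩ := hE
  obtain ⟨r, h₀, h₁⟩ : ∃ r, u 0 = r * Real.cos θ ∧ u 1 = r * Real.sin θ := by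
    have hsq := Real.sin_sq_add_cos_sq θ
    refine ⟨u 0 * Real.cos θ + u 1 * Real.sin θ, ?_, ?_⟩
    · linear_combination (-u 0) * hsq + Real.sin θ * hbc
    · linear_combination (-u 1) * hsq - Real.cos θ * hbc
  have hu : ∀ m ≤ L, u (m : ℕ) =
      r * sol (fun k : ℕ => E - V k) (Real.cos θ) (Real.sin θ) m := fun m hm => by
    have hsol := eq_sol_of_recurrence (w := fun k : ℕ => E - V k) (u := fun k : ℕ => u k)
      (N := L) (fun k hk => ?_) hm
    · simp only [Nat.cast_zero, Nat.cast_one] at hsol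
      rw [hsol, h₀, h₁, sol_eq_linear, sol_eq_linear _ (Real.cos θ)]
      ring
    · have hk' := hrec (k + 1) (by omega) (by omega)
      rw [add_sub_cancel_right, show (k : ℤ) + 1 + 1 = k + 2 by ring] at hk'
      push_cast
      linear_combination hk'
  have hr : r ≠ 0 := by
    rintro rfl
    lift n to ℕ using by omega
    exact hn (by rw [hu n (by omega), zero_mul])
  rw [eval_boundaryPoly]
  exact (mul_eq_zero.mp ((hu L le_rfl).symm.trans huL)).resolve_left hr

theorem mem_finiteSpectrum_of_eval_boundaryPoly {θ E : ℝ} {L : ℕ} (hL : 3 ≤ L)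
    (hE : (boundaryPoly V (Real.cos θ) (Real.sin θ) L).eval E = 0) :
    E ∈ finiteSpectrum V θ L := by
  rw [eval_boundaryPoly] at hE
  set s := sol (fun k : ℕ => E - V k) (Real.cos θ) (Real.sin θ)
  refine ⟨fun n => s n.toNat, ?_, mul_comm _ _, hE, fun n hn₁ hnL => ?_⟩
  · by_cases hsin : Real.sin θ = 0
    · have hcos : Real.cos θ ≠ 0 := fun h => by
        simpa [hsin, h] using Real.sin_sq_add_cos_sq θ
      refine ⟨2, by norm_num, by omega, ?_⟩
      simpa [s, sol_add_two, hsin] using hcos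
    · exact ⟨1, le_rfl, by omega, hsin⟩
  · obtain ⟨m, rfl⟩ : ∃ m : ℕ, n = m + 1 := ⟨(n - 1).toNat, by omega⟩
    have hprev : ((m : ℤ) + 1 - 1).toNat = m := by omega
    have hcur : ((m : ℤ) + 1).toNat = m + 1 := by omega
    have hnext : ((m : ℤ) + 1 + 1).toNat = m + 2 := by omega
    simp only [hprev, hcur, hnext]
    rw [show s (m + 2) = _ from sol_add_two _ _ _ m]
    push_cast
    ring

theorem finiteIDS_eq (θ : ℝ) {L : ℕ} (hL : 3 ≤ L) (E : ℝ) :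
    finiteIDS V θ L E =
      zeroCount (boundaryPoly V (Real.cos θ) (Real.sin θ) L) E / ((L : ℝ) - 1) := by
  have hspec : {E | E ∈ finiteSpectrum V θ L} =
      {E | (boundaryPoly V (Real.cos θ) (Real.sin θ) L).eval E = 0} :=
    Subset.antisymm (fun _ => eval_boundaryPoly_of_mem_finiteSpectrum V)
      fun _ => mem_finiteSpectrum_of_eval_boundaryPoly V hL
  simp only [Set.ext_iff, mem_ofPred_eq] at hspec
  simp only [finiteIDS, zeroCount, hspec]

theorem abs_zeroCount_boundary_sub_le {x y : ℝ} (hxy : x ≠ 0 ∨ y ≠ 0) {L : ℕ} (hL : 2 ≤ L)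
    (E : ℝ) :
    |(zeroCount (boundaryPoly V x y L) E : ℝ) - zeroCount (boundaryPoly V 0 1 L) E| ≤ 1 := by
  obtain ⟨m, rfl⟩ : ∃ m, L = m + 2 := ⟨L - 2, by omega⟩
  have hsplit : boundaryPoly V x y (m + 2) =
      -(C x * sol (fun k : ℕ => X - C (V ((k + 1 : ℕ) : ℤ))) 0 1 (m + 1)) +
        C y * boundaryPoly V 0 1 (m + 2) := by
    rw [boundaryPoly, sol_eq_linear, boundaryPoly_zero_one, sol_one_zero_succ, mul_neg]
  rcases eq_or_ne x 0 with rfl | hx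
  · have hy : C y ≠ 0 := C_ne_zero.mpr (hxy.resolve_left (not_not.mpr rfl))
    have hzero : zeroCount (boundaryPoly V 0 y (m + 2)) E =
        zeroCount (boundaryPoly V 0 1 (m + 2)) E := by
      simp only [zeroCount, hsplit, C_0, zero_mul, neg_zero, zero_add, eval_mul, eval_C,
        mul_eq_zero, C_ne_zero.mp hy, false_or]
    simp [hzero]
  · refine abs_zeroCount_sub_le_one (fun E => ?_) E
    have hpos := eval_wronskian_sol_shift_pos (fun k : ℕ => V k) m E
    rw [← boundaryPoly_zero_one V (m + 2)] at hpos
    rw [hsplit, wronskian_add_left, wronskian_neg_left, wronskian_C_mul_left,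
      wronskian_C_mul_left, wronskian_self_eq_zero, mul_zero, add_zero, eval_neg, eval_mul, eval_C]
    exact neg_ne_zero.mpr (mul_ne_zero hx hpos.ne')

theorem abs_zeroCount_dirichlet_add_sub_le {n : ℕ} (hn : 0 < n) (r : ℕ) (E : ℝ) :
    |(zeroCount (boundaryPoly V 0 1 (n + r)) E : ℝ) - zeroCount (boundaryPoly V 0 1 n) E| ≤ r := by
  obtain ⟨m, rfl⟩ : ∃ m, n = m + 1 := ⟨n - 1, by omega⟩
  have hstep : ∀ j, dist (zeroCount (boundaryPoly V 0 1 (m + 1 + j)) E : ℝ)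
      (zeroCount (boundaryPoly V 0 1 (m + 1 + (j + 1))) E) ≤ 1 := fun j => by
    refine abs_zeroCount_sub_le_one (fun E => ?_) E
    rw [boundaryPoly_zero_one, boundaryPoly_zero_one, add_right_comm, ← add_assoc,
      add_right_comm m 1 j]
    exact (eval_wronskian_sol_succ_pos (fun k : ℕ => V k) (m + j) E).ne'
  have hdist := dist_le_range_sum_of_dist_le (f := fun j =>
    (zeroCount (boundaryPoly V 0 1 (m + 1 + j)) E : ℝ)) (d := fun _ => 1) r fun {j} _ => hstep j
  rw [dist_comm, Real.dist_eq] at hdist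
  simpa only [Finset.sum_const, Finset.card_range, nsmul_one] using hdist

end BoundaryConditions

section ChebyshevNodes

open Polynomial

theorem sol_mul_period {R : Type*} [CommRing R] {w : ℕ → R} {p : ℕ} (hw : Function.Periodic w p)
    (N : ℕ) :
    sol w 0 1 (p * (N + 1)) = sol w 0 1 p * (Chebyshev.S R N).eval (trace w p) := by
  induction N using Nat.twoStepInduction with
  | zero => simp
  | one =>
    have hperiod := sol_add_two_mul_period hw 0 1 0
    rw [zero_add, zero_add, sol_zero, add_zero] at hperiod
    rw [one_add_one_eq_two, mul_comm p, hperiod, Nat.cast_one, Chebyshev.S_one, eval_X, mul_comm]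
  | more N ih₀ ih₁ =>
    have hperiod := sol_add_two_mul_period hw 0 1 (p * (N + 1))
    rw [show p * (N + 1) + 2 * p = p * (N + 2 + 1) by ring,
      show p * (N + 1) + p = p * (N + 1 + 1) by ring, ih₀, ih₁] at hperiod
    push_cast at hperiod ⊢
    rw [Chebyshev.S_add_two, eval_sub, eval_mul, eval_X]
    linear_combination hperiod

/-- The zeros `2 cos (π k / (N + 1))`, `1 ≤ k ≤ N`, of the rescaled Chebyshev polynomial
`Chebyshev.S ℝ N`. -/
def nodes (N : ℕ) : Finset ℝ :=
  (Finset.range N).image fun k : ℕ => 2 * Real.cos ((k + 1) * Real.pi / (N + 1))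

theorem eval_chebyshev_eq_zero_iff (N : ℕ) (d : ℝ) :
    (Chebyshev.S ℝ N).eval d = 0 ↔ d ∈ nodes N := by
  have hU : (Chebyshev.S ℝ N).eval d = (Chebyshev.U ℝ N).eval (d / 2) := by
    rw [← Chebyshev.S_comp_two_mul_X, eval_comp, eval_mul, eval_X, eval_ofNat,
      mul_div_cancel₀ d two_ne_zero]
  have hne : Chebyshev.U ℝ (N : ℤ) ≠ 0 := degree_ne_bot.mp (by simp)
  rw [hU, ← IsRoot.def, ← mem_roots hne, Chebyshev.roots_U_real, Finset.mem_val, nodes,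
    Finset.mem_image, Finset.mem_image]
  simp only [eq_div_iff (two_ne_zero (α := ℝ)), mul_comm]

theorem node_angle_mem_Ioo {N k : ℕ} (hk : k < N) :
    ((k : ℝ) + 1) * Real.pi / (N + 1) ∈ Ioo 0 Real.pi := by
  have hk' : (k : ℝ) + 1 < N + 1 := by exact_mod_cast Nat.succ_lt_succ hk
  refine ⟨by positivity, ?_⟩
  rw [div_lt_iff₀ (by positivity), mul_comm]
  exact mul_lt_mul_of_pos_left hk' Real.pi_pos

theorem abs_two_mul_cos_lt_two {β : ℝ} (hβ : β ∈ Ioo 0 Real.pi) : |2 * Real.cos β| < 2 := by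
  have hlt := Real.strictAntiOn_cos ⟨le_rfl, Real.pi_pos.le⟩ (Ioo_subset_Icc_self hβ) hβ.1
  have hgt := Real.strictAntiOn_cos (Ioo_subset_Icc_self hβ) ⟨Real.pi_pos.le, le_rfl⟩ hβ.2
  rw [Real.cos_zero] at hlt
  rw [Real.cos_pi] at hgt
  rw [abs_lt]
  constructor <;> linarith

theorem abs_lt_two_of_mem_nodes {N : ℕ} {t : ℝ} (ht : t ∈ nodes N) : |t| < 2 := by
  obtain ⟨k, hk, rfl⟩ := Finset.mem_image.mp ht
  exact abs_two_mul_cos_lt_two (node_angle_mem_Ioo (Finset.mem_range.mp hk))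

theorem injOn_node (N : ℕ) :
    InjOn (fun k : ℕ => 2 * Real.cos ((k + 1) * Real.pi / (N + 1))) (Finset.range N) := by
  intro k hk l hl heq
  have hangle := Real.injOn_cos
    (Ioo_subset_Icc_self (node_angle_mem_Ioo (Finset.mem_range.mp hk)))
    (Ioo_subset_Icc_self (node_angle_mem_Ioo (Finset.mem_range.mp hl)))
    (mul_left_cancel₀ two_ne_zero heq)
  have hN : (N : ℝ) + 1 ≠ 0 := by positivity
  rw [div_left_inj' hN, mul_left_inj' Real.pi_ne_zero] at hangle
  exact_mod_cast add_right_cancel hangle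

theorem card_nodes (N : ℕ) : (nodes N).card = N := by
  rw [nodes, Finset.card_image_of_injOn (injOn_node N), Finset.card_range]

theorem image_neg_nodes (N : ℕ) : (nodes N).image (-·) = nodes N := by
  have hneg : ∀ t ∈ nodes N, -t ∈ nodes N := fun t ht => by
    obtain ⟨k, hk, rfl⟩ := Finset.mem_image.mp ht
    have hkN := Finset.mem_range.mp hk
    refine Finset.mem_image.mpr ⟨N - 1 - k, Finset.mem_range.mpr (by omega), ?_⟩
    rw [← mul_neg, ← Real.cos_pi_sub, Nat.sub_sub, Nat.cast_sub (by omega)]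
    congr 2
    push_cast
    field_simp
    ring
  refine (Finset.image_subset_iff.mpr hneg).antisymm fun t ht => ?_
  exact Finset.mem_image.mpr ⟨-t, hneg t ht, neg_neg t⟩

theorem abs_card_filter_succ_le_sub_le {α : ℝ} (h₀ : 0 ≤ α) (h₁ : α ≤ 1) (N : ℕ) :
    |(((Finset.range N).filter fun k : ℕ => (k : ℝ) + 1 ≤ α * (N + 1)).card : ℝ) - N * α| ≤ 1 := by
  have hα : 0 ≤ α * ((N : ℝ) + 1) := by positivity
  have hfilter : ((Finset.range N).filter fun k : ℕ => (k : ℝ) + 1 ≤ α * (N + 1)) =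
      Finset.range (min N ⌊α * ((N : ℝ) + 1)⌋₊) := by
    ext k
    rw [Finset.mem_filter, Finset.mem_range, Finset.mem_range, lt_min_iff,
      ← Nat.succ_le_iff (n := ⌊_⌋₊), Nat.le_floor_iff hα, Nat.cast_succ]
  have hfloor := Nat.floor_le hα
  have hfloor' := Nat.lt_floor_add_one (α * ((N : ℝ) + 1))
  have : (0 : ℝ) ≤ N := Nat.cast_nonneg N
  rw [hfilter, Finset.card_range, Nat.cast_min, abs_le]
  rcases min_cases (N : ℝ) ⌊α * ((N : ℝ) + 1)⌋₊ with ⟨hmin, hle⟩ | ⟨hmin, _⟩ <;>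
    rw [hmin] <;> constructor <;> nlinarith

theorem abs_card_nodes_ge_sub_le {β : ℝ} (hβ : β ∈ Icc 0 Real.pi) (N : ℕ) :
    |(((nodes N).filter (2 * Real.cos β ≤ ·)).card : ℝ) - N * (β / Real.pi)| ≤ 1 := by
  have hfilter : (Finset.range N).filter
      (fun k : ℕ => 2 * Real.cos β ≤ 2 * Real.cos ((k + 1) * Real.pi / (N + 1))) =
        (Finset.range N).filter fun k : ℕ => (k : ℝ) + 1 ≤ β / Real.pi * (N + 1) :=
    Finset.filter_congr fun k hk => by
      have hangle := Ioo_subset_Icc_self (node_angle_mem_Ioo (Finset.mem_range.mp hk))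
      rw [mul_le_mul_iff_right₀ two_pos, Real.strictAntiOn_cos.le_iff_ge hβ hangle,
        div_le_iff₀ (by positivity), div_mul_eq_mul_div, le_div_iff₀ Real.pi_pos]
  rw [nodes, Finset.filter_image, Finset.card_image_of_injOn
    ((injOn_node N).mono (Finset.coe_subset.mpr (Finset.filter_subset _ _))), hfilter]
  exact abs_card_filter_succ_le_sub_le (div_nonneg hβ.1 Real.pi_pos.le)
    (div_le_one_of_le₀ hβ.2 Real.pi_pos.le) N

theorem abs_card_nodes_le_sub_le {β : ℝ} (hβ : β ∈ Icc 0 Real.pi) (N : ℕ) :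
    |(((nodes N).filter (· ≤ 2 * Real.cos β)).card : ℝ) - N * (1 - β / Real.pi)| ≤ 1 := by
  have hcard : ((nodes N).filter (· ≤ 2 * Real.cos β)).card =
      ((nodes N).filter (2 * Real.cos (Real.pi - β) ≤ ·)).card := by
    nth_rw 1 [← image_neg_nodes]
    rw [Finset.filter_image, Finset.card_image_of_injective _ neg_injective]
    simp only [Real.cos_pi_sub, mul_neg, neg_le]
  have hsymm := abs_card_nodes_ge_sub_le (β := Real.pi - β)
    ⟨sub_nonneg.mpr hβ.2, sub_le_self _ hβ.1⟩ N
  rwa [hcard, show 1 - β / Real.pi = (Real.pi - β) / Real.pi by field_simp]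

end ChebyshevNodes

section BandDensity

open Polynomial

theorem exists_angle {d : ℝ} (hd : |d| ≤ 2) : ∃ β ∈ Icc 0 Real.pi, d = 2 * Real.cos β := by
  obtain ⟨hlo, hhi⟩ := abs_le.mp hd
  refine ⟨Real.arccos (d / 2), ⟨Real.arccos_nonneg _, Real.arccos_le_pi _⟩, ?_⟩
  rw [Real.cos_arccos (by linarith) (by linarith), mul_div_cancel₀ d two_ne_zero]

theorem mul_mem_Icc_pi {c ϑ : ℝ} (hc : 0 < c) (hϑ : ϑ ∈ Icc 0 (Real.pi / c)) :
    c * ϑ ∈ Icc 0 Real.pi :=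
  ⟨mul_nonneg hc.le hϑ.1, (le_div_iff₀' hc).mp hϑ.2⟩

theorem existsUnique_angle {c d : ℝ} (hc : 0 < c) (hd : |d| ≤ 2) :
    ∃! ϑ : ℝ, ϑ ∈ Icc 0 (Real.pi / c) ∧ d = 2 * Real.cos (c * ϑ) := by
  obtain ⟨β, hβ, rfl⟩ := exists_angle hd
  refine ⟨β / c, ⟨⟨div_nonneg hβ.1 hc.le, div_le_div_of_nonneg_right hβ.2 hc.le⟩, ?_⟩, ?_⟩
  · rw [mul_div_cancel₀ β hc.ne']
  · rintro ϑ ⟨hϑ, heq⟩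
    rw [eq_div_iff hc.ne', mul_comm]
    exact Real.injOn_cos (mul_mem_Icc_pi hc hϑ) hβ (mul_left_cancel₀ two_ne_zero heq).symm

/-- The number of points of the open band `(a, b)` in `(-∞, E]` which `f` maps to a node, that is
of the zeros there of the composition of `Chebyshev.S ℝ N` with `f`. -/
def bandCount (f : ℝ[X]) (a b : ℝ) (N : ℕ) (E : ℝ) : ℕ :=
  {x ∈ Ioo a b | f.eval x ∈ nodes N ∧ x ≤ E}.ncard

/-- The fraction of the zeros in the band `[a, b]` which lie in `(-∞, E]` tends to `κ` for large
`N`, with a counting error of at most one. -/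
def HasDensity (f : ℝ[X]) (a b E κ : ℝ) : Prop :=
  ∀ N, |(bandCount f a b N E : ℝ) - N * κ| ≤ 1

namespace IsBand

variable {f : ℝ[X]} {a b E : ℝ}

theorem ncard_eval_mem (h : IsBand f a b) (hf : RealLevels f) (hdeg : 0 < f.degree)
    {S : Finset ℝ} (hS : ∀ t ∈ S, |t| < 2) : {x ∈ Ioo a b | f.eval x ∈ S}.ncard = S.card := by
  have himage : (fun x => f.eval x) '' {x ∈ Ioo a b | f.eval x ∈ S} = S := by
    refine Subset.antisymm (image_subset_iff.mpr fun x hx => hx.2) fun t ht => ?_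
    obtain ⟨x, hx, rfl⟩ := h.exists_eval_eq hf hdeg (hS t ht)
    exact ⟨x, ⟨hx, ht⟩, rfl⟩
  rw [← ncard_coe_finset, ← himage,
    InjOn.ncard_image ((h.injOn hf hdeg).mono fun x hx => Ioo_subset_Icc_self hx.1)]

theorem bandCount_eq_card (h : IsBand f a b) (hf : RealLevels f) (hdeg : 0 < f.degree) {N : ℕ}
    {S : Finset ℝ} (hS : S ⊆ nodes N)
    (hE : ∀ x ∈ Ioo a b, f.eval x ∈ nodes N → (x ≤ E ↔ f.eval x ∈ S)) :
    bandCount f a b N E = S.card := by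
  rw [← h.ncard_eval_mem hf hdeg fun t ht => abs_lt_two_of_mem_nodes (hS ht), bandCount]
  congr 1
  ext x
  exact and_congr_right fun hx =>
    ⟨fun hxE => (hE x hx hxE.1).mp hxE.2, fun hxS => ⟨hS hxS, (hE x hx (hS hxS)).mpr hxS⟩⟩

theorem hasDensity_one (h : IsBand f a b) (hf : RealLevels f) (hdeg : 0 < f.degree)
    (hE : b ≤ E) : HasDensity f a b E 1 := fun N => by
  rw [h.bandCount_eq_card hf hdeg Subset.rfl fun x hx hxN => iff_of_true (hx.2.le.trans hE) hxN,
    card_nodes, mul_one, sub_self, abs_zero]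
  exact zero_le_one

theorem hasDensity_zero (h : IsBand f a b) (hf : RealLevels f) (hdeg : 0 < f.degree)
    (hE : E ≤ a) : HasDensity f a b E 0 := fun N => by
  rw [h.bandCount_eq_card hf hdeg (Finset.empty_subset _) fun x hx _ =>
      iff_of_false (hE.trans_lt hx.1).not_ge (Finset.notMem_empty _),
    Finset.card_empty, Nat.cast_zero, mul_zero, sub_self, abs_zero]
  exact zero_le_one

theorem hasDensity_of_strictMonoOn (h : IsBand f a b) (hf : RealLevels f) (hdeg : 0 < f.degree)
    (hmono : StrictMonoOn (fun x => f.eval x) (Icc a b)) (hE : E ∈ Icc a b) {β : ℝ}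
    (hβ : β ∈ Icc 0 Real.pi) (hfE : f.eval E = 2 * Real.cos β) :
    HasDensity f a b E (1 - β / Real.pi) := fun N => by
  rw [h.bandCount_eq_card (S := (nodes N).filter (· ≤ 2 * Real.cos β)) hf hdeg
    (Finset.filter_subset _ _) fun x hx hxN => ?_]
  · exact abs_card_nodes_le_sub_le hβ N
  · rw [Finset.mem_filter, and_iff_right hxN, ← hfE,
      ← hmono.le_iff_le (Ioo_subset_Icc_self hx) hE]

theorem hasDensity_of_strictAntiOn (h : IsBand f a b) (hf : RealLevels f) (hdeg : 0 < f.degree)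
    (hanti : StrictAntiOn (fun x => f.eval x) (Icc a b)) (hE : E ∈ Icc a b) {β : ℝ}
    (hβ : β ∈ Icc 0 Real.pi) (hfE : f.eval E = 2 * Real.cos β) :
    HasDensity f a b E (β / Real.pi) := fun N => by
  rw [h.bandCount_eq_card (S := (nodes N).filter (2 * Real.cos β ≤ ·)) hf hdeg
    (Finset.filter_subset _ _) fun x hx hxN => ?_]
  · exact abs_card_nodes_ge_sub_le hβ N
  · rw [Finset.mem_filter, and_iff_right hxN, ← hfE,
      ← hanti.le_iff_ge hE (Ioo_subset_Icc_self hx)]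

theorem exists_hasDensity (h : IsBand f a b) (hf : RealLevels f) (hdeg : 0 < f.degree) (E : ℝ) :
    ∃ κ, HasDensity f a b E κ := by
  rcases le_total E a with hEa | haE
  · exact ⟨0, h.hasDensity_zero hf hdeg hEa⟩
  rcases le_total b E with hbE | hEb
  · exact ⟨1, h.hasDensity_one hf hdeg hbE⟩
  have hE : E ∈ Icc a b := ⟨haE, hEb⟩
  obtain ⟨β, hβ, hfE⟩ := exists_angle (h.abs_le hE)
  rcases f.continuous.continuousOn.strictMonoOn_of_injOn_Icc' h.lt.le (h.injOn hf hdeg)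
    with hmono | hanti
  · exact ⟨_, h.hasDensity_of_strictMonoOn hf hdeg hmono hE hβ hfE⟩
  · exact ⟨_, h.hasDensity_of_strictAntiOn hf hdeg hanti hE hβ hfE⟩

end IsBand

namespace IsBandSystem

variable {f : ℝ[X]} {p : ℕ} {a b : ℕ → ℝ}

theorem zeroCount_chebyshev_comp (h : IsBandSystem f p a b) (hf : RealLevels f)
    (hdeg : 0 < f.degree) (N : ℕ) (E : ℝ) :
    zeroCount ((Chebyshev.S ℝ N).comp f) E =
      ∑ j ∈ Finset.Icc 1 p, bandCount f (a j) (b j) N E := by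
  have hunion : {x | ((Chebyshev.S ℝ N).comp f).eval x = 0 ∧ x ≤ E} =
      ⋃ j ∈ (Finset.Icc 1 p : Set ℕ), {x ∈ Ioo (a j) (b j) | f.eval x ∈ nodes N ∧ x ≤ E} := by
    ext x
    simp only [eval_comp, eval_chebyshev_eq_zero_iff, mem_ofPred_eq, mem_iUnion₂,
      Finset.coe_Icc, exists_prop]
    refine ⟨fun hx => ?_, fun ⟨_, _, _, hx⟩ => hx⟩
    obtain ⟨j, h₁, h₂, hxj⟩ := h.exists_mem_Ioo (abs_lt_two_of_mem_nodes hx.1)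
    exact ⟨j, ⟨h₁, h₂⟩, hxj, hx⟩
  rw [zeroCount, hunion, (Finset.finite_toSet _).ncard_biUnion, finsum_mem_coe_finset]
  · rfl
  · intro j hj
    rw [Finset.coe_Icc] at hj
    exact (nodes N).finite_toSet.of_injOn (fun x hx => hx.2.1)
      (((h.isBand j hj.1 hj.2).injOn hf hdeg).mono fun x hx => Ioo_subset_Icc_self hx.1)
  · intro i hi j hj hij
    rw [Finset.coe_Icc] at hi hj
    refine disjoint_left.mpr fun x hxi hxj => ?_
    rcases hij.lt_or_gt with hlt | hgt
    · exact ((h.right_le_left hi.1 hlt hj.2).trans_lt hxj.1.1).not_gt hxi.1.2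
    · exact ((h.right_le_left hj.1 hgt hi.2).trans_lt hxi.1.1).not_gt hxj.1.2

theorem abs_zeroCount_chebyshev_comp_sub_le (h : IsBandSystem f p a b) (hf : RealLevels f)
    (hdeg : 0 < f.degree) {E : ℝ} {κ : ℕ → ℝ}
    (hκ : ∀ j, 1 ≤ j → j ≤ p → HasDensity f (a j) (b j) E (κ j)) (N : ℕ) :
    |(zeroCount ((Chebyshev.S ℝ N).comp f) E : ℝ) - N * ∑ j ∈ Finset.Icc 1 p, κ j| ≤ p := by
  rw [h.zeroCount_chebyshev_comp hf hdeg, Nat.cast_sum, Finset.mul_sum,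
    ← Finset.sum_sub_distrib]
  calc |∑ j ∈ Finset.Icc 1 p, ((bandCount f (a j) (b j) N E : ℝ) - N * κ j)|
      ≤ ∑ j ∈ Finset.Icc 1 p, |(bandCount f (a j) (b j) N E : ℝ) - N * κ j| :=
        Finset.abs_sum_le_sum_abs _ _
    _ ≤ ∑ _j ∈ Finset.Icc 1 p, (1 : ℝ) := Finset.sum_le_sum fun j hj =>
        hκ j (Finset.mem_Icc.mp hj).1 (Finset.mem_Icc.mp hj).2 N
    _ = p := by simp

end IsBandSystem

end BandDensity

section DensityOfStates

open Polynomial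

variable {p : ℕ} {V : ℤ → ℝ} {a b : ℕ → ℝ} {k : ℝ → ℝ} {E : ℝ}

theorem boundaryPoly_mul_period (hV : Function.Periodic V (p : ℤ)) (N : ℕ) :
    boundaryPoly V 0 1 (p * (N + 1)) =
      boundaryPoly V 0 1 p * (Chebyshev.S ℝ N).comp (discPoly p V) := by
  have hw : Function.Periodic (fun k : ℕ => X - C (V k)) p := fun k => by
    simp only [Nat.cast_add, hV (k : ℤ)]
  rw [boundaryPoly_zero_one, boundaryPoly_zero_one, sol_mul_period hw, comp, ← eval_map,
    Chebyshev.map_S, discPoly]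

theorem abs_zeroCount_dirichlet_period_sub_le (hp : 0 < p) (hV : Function.Periodic V (p : ℤ))
    (h : IsBandSystem (discPoly p V) p a b) {κ : ℕ → ℝ}
    (hκ : ∀ j, 1 ≤ j → j ≤ p → HasDensity (discPoly p V) (a j) (b j) E (κ j)) (N : ℕ) :
    |(zeroCount (boundaryPoly V 0 1 (p * (N + 1))) E : ℝ) - N * ∑ j ∈ Finset.Icc 1 p, κ j| ≤
      zeroCount (boundaryPoly V 0 1 p) E + p := by
  have hne := boundaryPoly_zero_one_ne_zero V (Nat.mul_pos hp N.succ_pos)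
  rw [boundaryPoly_mul_period hV] at hne ⊢
  exact (abs_sub_le _ _ _).trans (add_le_add (abs_zeroCount_mul_sub_le hne E)
    (h.abs_zeroCount_chebyshev_comp_sub_le (realLevels_discPoly hp hV) (degree_discPoly_pos hp V)
      hκ N))

theorem exists_abs_zeroCount_boundary_sub_le (hp : 0 < p) (hV : Function.Periodic V (p : ℤ))
    (h : IsBandSystem (discPoly p V) p a b) {κ : ℕ → ℝ}
    (hκ : ∀ j, 1 ≤ j → j ≤ p → HasDensity (discPoly p V) (a j) (b j) E (κ j)) {x y : ℝ}
    (hxy : x ≠ 0 ∨ y ≠ 0) :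
    ∃ C : ℝ, ∀ L : ℕ, p + 2 ≤ L →
      |(zeroCount (boundaryPoly V x y L) E : ℝ) - L * ((∑ j ∈ Finset.Icc 1 p, κ j) / p)| ≤ C := by
  set S := ∑ j ∈ Finset.Icc 1 p, κ j
  refine ⟨1 + p + (zeroCount (boundaryPoly V 0 1 p) E + p) + 2 * |S|, fun L hL => ?_⟩
  obtain ⟨N, hN⟩ : ∃ N, L / p = N + 1 :=
    ⟨L / p - 1, by have := Nat.div_pos (by omega : p ≤ L) hp; omega⟩
  obtain ⟨r, hr, rfl⟩ : ∃ r ≤ p, L = p * (N + 1) + r :=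
    ⟨L % p, (L.mod_lt hp).le, by rw [← hN, Nat.div_add_mod]⟩
  have hboundary := abs_zeroCount_boundary_sub_le V hxy (by omega : 2 ≤ p * (N + 1) + r) E
  have hremainder := (abs_zeroCount_dirichlet_add_sub_le V (Nat.mul_pos hp N.succ_pos) r E).trans
    (Nat.cast_le.mpr hr)
  have hperiod := abs_zeroCount_dirichlet_period_sub_le hp hV h hκ N
  have hscale : |(N : ℝ) * S - (p * (N + 1) + r : ℕ) * (S / p)| ≤ 2 * |S| := by
    have hp' : (0 : ℝ) < p := Nat.cast_pos.mpr hp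
    have hdiff : (N : ℝ) * S - (p * (N + 1) + r : ℕ) * (S / p) = -(1 + r / p) * S := by
      push_cast
      field_simp
      ring
    rw [hdiff, abs_mul, abs_neg, abs_of_nonneg (by positivity)]
    have hr' : (r : ℝ) / p ≤ 1 := div_le_one_of_le₀ (Nat.cast_le.mpr hr) hp'.le
    exact mul_le_mul_of_nonneg_right (by linarith) (abs_nonneg S)
  rw [abs_le] at hboundary hremainder hperiod hscale ⊢
  constructor <;> linarith [hboundary.1, hboundary.2, hremainder.1, hremainder.2, hperiod.1,
    hperiod.2, hscale.1, hscale.2]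

theorem tendsto_div_sub_one_of_abs_sub_le {c : ℕ → ℝ} {s C : ℝ}
    (h : ∀ᶠ L : ℕ in atTop, |c L - L * s| ≤ C) :
    Tendsto (fun L : ℕ => c L / ((L : ℝ) - 1)) atTop (𝓝 s) := by
  have hT : Tendsto (fun L : ℕ => (L : ℝ) - 1) atTop atTop :=
    tendsto_atTop_add_const_right _ (-1) tendsto_natCast_atTop_atTop
  have hbound : ∀ᶠ L : ℕ in atTop, ‖c L / ((L : ℝ) - 1) - s‖ ≤ (C + |s|) / ((L : ℝ) - 1) := by
    filter_upwards [h, hT.eventually_gt_atTop 0] with L hL hpos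
    have hdiff : c L / ((L : ℝ) - 1) - s = ((c L - L * s) + s) / ((L : ℝ) - 1) := by
      field_simp
      ring
    rw [hdiff, Real.norm_eq_abs, abs_div, abs_of_pos hpos]
    exact div_le_div_of_nonneg_right
      ((abs_add_le _ _).trans (add_le_add_left hL _)) hpos.le
  exact tendsto_iff_norm_sub_tendsto_zero.mpr
    (squeeze_zero' (.of_forall fun _ => norm_nonneg _) hbound (tendsto_const_nhds.div_atTop hT))

theorem tendsto_finiteIDS (hp : 0 < p) (hV : Function.Periodic V (p : ℤ))
    (h : IsBandSystem (discPoly p V) p a b) {κ : ℕ → ℝ}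
    (hκ : ∀ j, 1 ≤ j → j ≤ p → HasDensity (discPoly p V) (a j) (b j) E (κ j)) (θ : ℝ) :
    Tendsto (fun L : ℕ => finiteIDS V θ L E) atTop (𝓝 ((∑ j ∈ Finset.Icc 1 p, κ j) / p)) := by
  have hθ : Real.cos θ ≠ 0 ∨ Real.sin θ ≠ 0 := by
    by_contra! hzero
    simpa [hzero] using Real.sin_sq_add_cos_sq θ
  obtain ⟨C, hC⟩ := exists_abs_zeroCount_boundary_sub_le hp hV h hκ hθ
  have hbound : ∀ᶠ L : ℕ in atTop,
      |(zeroCount (boundaryPoly V (Real.cos θ) (Real.sin θ) L) E : ℝ) -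
        L * ((∑ j ∈ Finset.Icc 1 p, κ j) / p)| ≤ C :=
    (eventually_ge_atTop (p + 2)).mono hC
  refine (tendsto_div_sub_one_of_abs_sub_le hbound).congr' ?_
  filter_upwards [eventually_ge_atTop 3] with L hL
  rw [finiteIDS_eq V θ hL]

theorem exists_isIDS (hp : 0 < p) (hV : Function.Periodic V (p : ℤ)) : ∃ k, IsIDS V k := by
  obtain ⟨a, b, hbands⟩ := exists_isBands hp hV
  have h := (isBands_iff_isBandSystem hp hV).mp hbands
  have hdensity : ∀ E j, ∃ κ, 1 ≤ j → j ≤ p → HasDensity (discPoly p V) (a j) (b j) E κ :=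
    fun E j => by
      by_cases hj : 1 ≤ j ∧ j ≤ p
      · obtain ⟨κ, hκ⟩ := (h.isBand j hj.1 hj.2).exists_hasDensity (realLevels_discPoly hp hV)
          (degree_discPoly_pos hp V) E
        exact ⟨κ, fun _ _ => hκ⟩
      · exact ⟨0, fun h₁ h₂ => absurd ⟨h₁, h₂⟩ hj⟩
  choose κ hκ using hdensity
  exact ⟨_, fun E θ => tendsto_finiteIDS hp hV h (hκ E) θ⟩

theorem ids_eq (hp : 0 < p) (hV : Function.Periodic V (p : ℤ))
    (h : IsBandSystem (discPoly p V) p a b) (hk : IsIDS V k) {κ : ℕ → ℝ}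
    (hκ : ∀ j, 1 ≤ j → j ≤ p → HasDensity (discPoly p V) (a j) (b j) E (κ j)) :
    k E = (∑ j ∈ Finset.Icc 1 p, κ j) / p :=
  tendsto_nhds_unique (hk E 0) (tendsto_finiteIDS hp hV h hκ 0)

theorem ids_eq_of_between (hp : 0 < p) (hV : Function.Periodic V (p : ℤ))
    (h : IsBandSystem (discPoly p V) p a b) (hk : IsIDS V k) {j : ℕ} (hj : j ≤ p)
    (hleft : 1 ≤ j → b j ≤ E) (hright : j < p → E ≤ a (j + 1)) : k E = (j : ℝ) / p := by
  have hf := realLevels_discPoly hp hV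
  have hdeg := degree_discPoly_pos hp V
  rw [ids_eq hp hV h hk (κ := fun i => if i ≤ j then 1 else 0) fun i h₁ h₂ => ?_]
  · have hfilter : (Finset.Icc 1 p).filter (· ≤ j) = Finset.Icc 1 j := by
      ext i
      simp only [Finset.mem_filter, Finset.mem_Icc]
      omega
    rw [Finset.sum_boole, hfilter, Nat.card_Icc, Nat.add_sub_cancel]
  · split_ifs with hij
    · exact (h.isBand i h₁ h₂).hasDensity_one hf hdeg
        ((h.right_mono h₁ hij hj).trans (hleft (h₁.trans hij)))
    · exact (h.isBand i h₁ h₂).hasDensity_zero hf hdeg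
        ((hright (by omega)).trans (h.left_mono (by omega) (by omega) h₂))

theorem ids_eq_of_mem_gap (hp : 0 < p) (hV : Function.Periodic V (p : ℤ))
    (h : IsBandSystem (discPoly p V) p a b) (hk : IsIDS V k) {j : ℕ} (hj : j ≤ p)
    (hE : E ∈ gap p a b j) : k E = (j : ℝ) / p := by
  rw [gap] at hE
  split_ifs at hE with hzero hlast hopen
  · subst hzero
    exact ids_eq_of_between hp hV h hk hj (fun h₁ => absurd h₁ (by omega)) fun _ => hE.le
  · subst hlast
    exact ids_eq_of_between hp hV h hk hj (fun _ => hE.le) fun hlt => absurd hlt (lt_irrefl _)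
  · exact ids_eq_of_between hp hV h hk hj (fun _ => hE.1.le) fun _ => hE.2.le
  · exact ids_eq_of_between hp hV h hk hj (fun _ => hE.ge) fun hlt =>
      hE.le.trans (h.le j (by omega) hlt)

theorem ids_eq_of_hasDensity (hp : 0 < p) (hV : Function.Periodic V (p : ℤ))
    (h : IsBandSystem (discPoly p V) p a b) (hk : IsIDS V k) {j : ℕ} (h₁ : 1 ≤ j) (h₂ : j ≤ p)
    (hE : E ∈ Icc (a j) (b j)) {κ : ℝ} (hκ : HasDensity (discPoly p V) (a j) (b j) E κ) :
    k E = ((j : ℝ) - 1 + κ) / p := by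
  have hf := realLevels_discPoly hp hV
  have hdeg := degree_discPoly_pos hp V
  rw [ids_eq hp hV h hk (κ := fun i => (if i < j then 1 else 0) + if i = j then κ else 0)
    fun i hi₁ hi₂ => ?_]
  · have hfilter : (Finset.Icc 1 p).filter (· < j) = Finset.Ico 1 j := by
      ext i
      simp only [Finset.mem_filter, Finset.mem_Icc, Finset.mem_Ico]
      omega
    rw [Finset.sum_add_distrib, Finset.sum_boole, Finset.sum_ite_eq',
      if_pos (Finset.mem_Icc.mpr ⟨h₁, h₂⟩), hfilter, Nat.card_Ico, Nat.cast_sub h₁, Nat.cast_one]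
  · rcases lt_trichotomy i j with hij | rfl | hij
    · simpa [hij, hij.ne] using (h.isBand i hi₁ hi₂).hasDensity_one hf hdeg
        ((h.right_le_left hi₁ hij h₂).trans hE.1)
    · simpa using hκ
    · simpa [hij.not_gt, hij.ne'] using (h.isBand i hi₁ hi₂).hasDensity_zero hf hdeg
        (hE.2.trans (h.right_le_left h₁ hij hi₂))

theorem ids_eq_of_even (hp : 0 < p) (hV : Function.Periodic V (p : ℤ))
    (h : IsBandSystem (discPoly p V) p a b) (hk : IsIDS V k) {j : ℕ} (h₁ : 1 ≤ j) (h₂ : j ≤ p)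
    (heven : Even (p - j)) (hE : E ∈ Icc (a j) (b j)) {ϑ : ℝ} (hϑ : ϑ ∈ Icc 0 (Real.pi / p))
    (hD : (discPoly p V).eval E = 2 * Real.cos (p * ϑ)) :
    k E = (j : ℝ) / p - ϑ / Real.pi := by
  have hp' : (0 : ℝ) < p := Nat.cast_pos.mpr hp
  have hf := realLevels_discPoly hp hV
  have hdeg := degree_discPoly_pos hp V
  have hmono := h.strictMonoOn hf hdeg (leadingCoeff_discPoly_nonneg hp V) h₁ h₂ heven
  rw [ids_eq_of_hasDensity hp hV h hk h₁ h₂ hE ((h.isBand j h₁ h₂).hasDensity_of_strictMonoOn hf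
    hdeg hmono hE (mul_mem_Icc_pi hp' hϑ) hD)]
  field_simp
  ring

theorem ids_eq_of_odd (hp : 0 < p) (hV : Function.Periodic V (p : ℤ))
    (h : IsBandSystem (discPoly p V) p a b) (hk : IsIDS V k) {j : ℕ} (h₁ : 1 ≤ j) (h₂ : j ≤ p)
    (hodd : Odd (p - j)) (hE : E ∈ Icc (a j) (b j)) {ϑ : ℝ} (hϑ : ϑ ∈ Icc 0 (Real.pi / p))
    (hD : (discPoly p V).eval E = 2 * Real.cos (p * ϑ)) :
    k E = ((j : ℝ) - 1) / p + ϑ / Real.pi := by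
  have hp' : (0 : ℝ) < p := Nat.cast_pos.mpr hp
  have hf := realLevels_discPoly hp hV
  have hdeg := degree_discPoly_pos hp V
  have hanti := h.strictAntiOn hf hdeg (leadingCoeff_discPoly_nonneg hp V) h₁ h₂ hodd
  rw [ids_eq_of_hasDensity hp hV h hk h₁ h₂ hE ((h.isBand j h₁ h₂).hasDensity_of_strictAntiOn hf
    hdeg hanti hE (mul_mem_Icc_pi hp' hϑ) hD)]
  field_simp

end DensityOfStates

end PeriodicJacobi

end

open PeriodicJacobi in
theorem theorem1p1 (p : ℕ) (hp : 0 < p) (V : ℤ → ℝ) (hV : Function.Periodic V (p : ℤ)) :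
    ∃ k : ℝ → ℝ, IsIDS V k ∧
      (∃ a b : ℕ → ℝ, IsBands p V (bounded_of_periodic hp hV) a b) ∧
      ∀ a b : ℕ → ℝ, IsBands p V (bounded_of_periodic hp hV) a b →
        (∀ j ≤ p, ∀ E ∈ gap p a b j, k E = (j : ℝ) / p) ∧
        (∀ j, 1 ≤ j → j ≤ p → ∀ E ∈ Set.Icc (a j) (b j),
          (∃! ϑ : ℝ, ϑ ∈ Set.Icc 0 (Real.pi / p) ∧
            discriminant p V E = 2 * Real.cos (p * ϑ)) ∧
          ∀ ϑ ∈ Set.Icc 0 (Real.pi / p), discriminant p V E = 2 * Real.cos (p * ϑ) →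
            (Even (p - j) → k E = (j : ℝ) / p - ϑ / Real.pi) ∧
            (Odd (p - j) → k E = ((j : ℝ) - 1) / p + ϑ / Real.pi)) := by
  obtain ⟨k, hk⟩ := exists_isIDS hp hV
  refine ⟨k, hk, exists_isBands hp hV, fun a b hbands => ?_⟩
  have h := (isBands_iff_isBandSystem hp hV).mp hbands
  refine ⟨fun j hj E hE => ids_eq_of_mem_gap hp hV h hk hj hE, fun j h₁ h₂ E hE => ?_⟩
  rw [← eval_discPoly]
  exact ⟨existsUnique_angle (Nat.cast_pos.mpr hp) ((h.isBand j h₁ h₂).abs_le hE),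
    fun ϑ hϑ hD => ⟨fun heven => ids_eq_of_even hp hV h hk h₁ h₂ heven hE hϑ hD,
      fun hodd => ids_eq_of_odd hp hV h hk h₁ h₂ hodd hE hϑ hD⟩⟩
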